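/- Let $\mathcal G$ be a locally compact Hausdorff étale groupoid with unit space $\mathcal G^{(0)}$, range map $r$ and source map $s$. For $x\in\mathcal G^{(0)}$ put $\mathcal G_x=s^{-1}(x)$, $\mathcal G^x=r^{-1}(x)$ and $\mathcal G^x_x=\mathcal G_x\cap\mathcal G^x$. Let $C_c(\mathcal G)$ be the $*$-algebra of continuous compactly supported functions $f:\mathcal G\to\mathbb C$, with product $(f_1*f_2)(g)=\sum_{h\in\mathcal G^{r(g)}}f_1(h)f_2(h^{-1}g)$ and involution $f^*(g)=\overline{f(g^{-1})}$, and let $C^*_r(\mathcal G)$ be its completion in the norm $\|f\|_r=\sup_{x\in\mathcal G^{(0)}}\|\pi_x(f)\|$, where $\pi_x$ is the representation of $C_c(\mathcal G)$ on $\ell^2(\mathcal G_x)$ given by $(\pi_x(f)\psi)(g)=\sum_{h\in\mathcal G^{r(g)}}f(h)\psi(h^{-1}g)$. The algebra $C_0(\mathcal G^{(0)})$ is regarded as a subalgebra of $C^*_r(\mathcal G)$ via the extension by zero $C_c(\mathcal G^{(0)})\subseteq C_c(\mathcal G)$ ($\mathcal G^{(0)}$ being open and closed in $\mathcal G$). Assume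 that $\mathcal G$ is topologically principal, i.e. that the elements $x\in\mathcal G^{(0)}$ with trivial isotropy group, $\mathcal G^x_x=\{x\}$, are dense in $\mathcal G^{(0)}$. Let $\alpha=(\alpha_t)_{t\in\mathbb R}$ be a continuous one-parameter group of $*$-automorphisms of $C^*_r(\mathcal G)$ (that is, $\alpha_{s+t}=\alpha_s\circ\alpha_t$, and $t\mapsto\alpha_t(a)$ is norm continuous for every $a\in C^*_r(\mathcal G)$) such that $\alpha_t(f)=f$ for all $f\in C_0(\mathcal G^{(0)})$ and all $t\in\mathbb R$. Then there is a continuous homomorphism $c:\mathcal G\to\mathbb R$ (that is, $c(gh)=c(g)+c(h)$ whenever $s(g)=r(h)$) such that, for all $t\in\mathbb R$ and all $f\in C_c(\mathcal G)$, the element $\alpha_t(f)$ of $C^*_r(\mathcal G)$ is the function in $C_c(\mathcal G)$ given by $$\alpha_t(f)(\xi)=e^{itc(\xi)}f(\xi),\qquad \xi\in\mathcal G;$$ in other words, $\alpha=\sigma^c$. -/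

import Mathlib

open scoped ENNReal CompactlySupported ZeroAtInfty Topology

/-- The algebraic structure of a groupoid on its set `G` of arrows. The unit space is the set of
arrows fixed by `src`. The product `mul g h` is only meaningful for composable pairs, i.e. when
`src g = rng h`; for all other pairs its value is irrelevant and never used. -/
class ArrowGroupoid (G : Type*) where
  src : G → G
  rng : G → G
  inv : G → G
  mul : G → G → G
  src_src : ∀ g, src (src g) = src g
  rng_src : ∀ g, rng (src g) = src g
  src_rng : ∀ g, src (rng g) = rng g
  rng_rng : ∀ g, rng (rng g) = rng g
  src_mul : ∀ g h, src g = rng h → src (mul g h) = src h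
  rng_mul : ∀ g h, src g = rng h → rng (mul g h) = rng g
  mul_assoc : ∀ g h k, src g = rng h → src h = rng k → mul (mul g h) k = mul g (mul h k)
  rng_mul_self : ∀ g, mul (rng g) g = g
  mul_src_self : ∀ g, mul g (src g) = g
  src_inv : ∀ g, src (inv g) = rng g
  rng_inv : ∀ g, rng (inv g) = src g
  mul_inv : ∀ g, mul g (inv g) = rng g
  inv_mul : ∀ g, mul (inv g) g = src g

namespace ArrowGroupoid

section Algebra

variable {G : Type*} [ArrowGroupoid G]

variable (G) in
/-- The unit space `G⁽⁰⁾`, as a subset of `G`. -/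
def units : Set G := {x | src x = x}

/-- The range map `r : G → G⁽⁰⁾`. -/
def rngUnit (g : G) : units G := ⟨rng g, src_rng g⟩

/-- The source map `s : G → G⁽⁰⁾`. -/
def srcUnit (g : G) : units G := ⟨src g, src_src g⟩

/-- `G_x = s⁻¹(x)`. -/
abbrev SrcFiber (x : units G) : Type _ := {g : G // src g = x}

/-- `G^x = r⁻¹(x)`. -/
abbrev RngFiber (x : units G) : Type _ := {g : G // rng g = x}

theorem rng_unit {x : G} (hx : x ∈ units G) : rng x = x := by
  have h : src x = x := hx
  have := rng_src x
  rwa [h] at this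

theorem inv_unit {x : G} (hx : x ∈ units G) : inv x = x := by
  have h := rng_mul_self (inv x)
  rw [rng_inv, show src x = x from hx, mul_inv, rng_unit hx] at h
  exact h.symm

theorem inv_mul_cancel_left {g h : G} (p : src g = rng h) : mul (inv g) (mul g h) = h := by
  rw [← mul_assoc _ _ _ (src_inv g) p, inv_mul, p, rng_mul_self]

theorem mul_inv_cancel_left {g h : G} (p : rng g = rng h) : mul g (mul (inv g) h) = h := by
  rw [← mul_assoc _ _ _ (rng_inv g).symm ((src_inv g).trans p), mul_inv, p, rng_mul_self]

theorem mul_inv_cancel_right {g h : G} (p : src g = rng h) : mul (mul g h) (inv h) = g := by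
  rw [mul_assoc _ _ _ p (rng_inv h).symm, mul_inv, ← p, mul_src_self]

theorem inv_mul_cancel_right {g h : G} (p : src g = src h) : mul (mul g (inv h)) h = g := by
  rw [mul_assoc _ _ _ (p.trans (rng_inv h).symm) (src_inv h), inv_mul, ← p, mul_src_self]

theorem inv_inv (g : G) : inv (inv g) = g := by
  have h := inv_mul_cancel_left (g := inv g) (h := g) (src_inv g)
  rw [inv_mul, ← rng_inv g, ← src_inv (inv g), mul_src_self] at h
  exact h

theorem inv_mul_rev {g h : G} (p : src g = rng h) : inv (mul g h) = mul (inv h) (inv g) := by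
  have q : src (inv h) = rng (inv g) := by rw [src_inv, rng_inv, p]
  have h1 : mul (mul g h) (mul (inv h) (inv g)) = rng (mul g h) := by
    rw [← mul_assoc _ _ _ (by rw [src_mul _ _ p, rng_inv]) q, mul_inv_cancel_right p, mul_inv,
      rng_mul _ _ p]
  have h2 := inv_mul_cancel_left (g := mul g h) (h := mul (inv h) (inv g))
    (by rw [src_mul _ _ p, rng_mul _ _ q, rng_inv])
  rw [← h2, h1, ← src_inv (mul g h), mul_src_self]

theorem src_inv_mul {g h : G} (p : rng h = rng g) : src (mul (inv h) g) = src g :=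
  src_mul _ _ ((src_inv h).trans p)

theorem rng_inv_mul {g h : G} (p : rng h = rng g) : rng (mul (inv h) g) = src h :=
  (rng_mul _ _ ((src_inv h).trans p)).trans (rng_inv h)

theorem src_mul_inv {g h : G} (p : src g = src h) : src (mul g (inv h)) = rng h :=
  (src_mul _ _ (p.trans (rng_inv h).symm)).trans (src_inv h)

theorem rng_mul_inv {g h : G} (p : src g = src h) : rng (mul g (inv h)) = rng g :=
  rng_mul _ _ (p.trans (rng_inv h).symm)

/-- For `g ∈ G_x`, the bijection `G^{r(g)} ≃ G_x`, `h ↦ h⁻¹ g`. -/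
def fiberEquiv (x : units G) (g : SrcFiber x) : RngFiber (rngUnit g.1) ≃ SrcFiber x where
  toFun h := ⟨mul (inv h.1) g.1, (src_inv_mul h.2).trans g.2⟩
  invFun k := ⟨mul g.1 (inv k.1), rng_mul_inv (g.2.trans k.2.symm)⟩
  left_inv h := by
    have h2 : rng h.1 = rng g.1 := h.2
    apply Subtype.ext
    change mul g.1 (inv (mul (inv h.1) g.1)) = h.1
    rw [inv_mul_rev ((src_inv h.1).trans h2), inv_inv, mul_inv_cancel_left h2.symm]
  right_inv k := by
    have p : src g.1 = src k.1 := g.2.trans k.2.symm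
    apply Subtype.ext
    change mul (inv (mul g.1 (inv k.1))) g.1 = k.1
    rw [inv_mul_rev (p.trans (rng_inv _).symm), inv_inv, inv_mul_cancel_right p.symm]

theorem tsum_fiber (x : units G) (g : SrcFiber x) (F : G → G → ℂ) :
    ∑' h : RngFiber (rngUnit g.1), F h.1 (mul (inv h.1) g.1) =
      ∑' k : SrcFiber x, F (mul g.1 (inv k.1)) k.1 := by
  rw [← (fiberEquiv x g).symm.tsum_eq]
  refine tsum_congr fun k => ?_
  have : mul (inv (mul g.1 (inv k.1))) g.1 = k.1 :=
    congrArg Subtype.val ((fiberEquiv x g).apply_symm_apply k)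
  change F (mul g.1 (inv k.1)) (mul (inv (mul g.1 (inv k.1))) g.1) = _
  rw [this]

theorem tsum_fiber' (x : units G) (f : G → ℂ) (ψ : SrcFiber x → ℂ) (g : SrcFiber x) :
    ∑' h : RngFiber (rngUnit g.1), f h.1 * ψ (fiberEquiv x g h) =
      ∑' k : SrcFiber x, f (mul g.1 (inv k.1)) * ψ k := by
  rw [← (fiberEquiv x g).symm.tsum_eq]
  refine tsum_congr fun k => ?_
  rw [Equiv.apply_symm_apply]
  rfl

end Algebra

end ArrowGroupoid

open ArrowGroupoid in
/-- An étale groupoid: the product (on the space of composable pairs, with the topology induced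
from `G × G`) and the inversion are continuous, and the range map `G → G⁽⁰⁾` is a local
homeomorphism, where `G⁽⁰⁾` carries the subspace topology. -/
class IsEtaleGroupoid (G : Type*) [TopologicalSpace G] [ArrowGroupoid G] : Prop where
  continuous_mul :
    Continuous fun p : {p : G × G // src p.1 = rng p.2} => mul p.1.1 p.1.2
  continuous_inv : Continuous (inv : G → G)
  isLocalHomeomorph_rng : IsLocalHomeomorph (rngUnit : G → units G)

namespace ArrowGroupoid

/-- The Hilbert space of square-summable functions on `ι`. -/
abbrev L2 (ι : Type*) : Type _ := lp (fun _ : ι => ℂ) 2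

section Schur

/-- Schur's test: a matrix with finitely supported rows and bounded row and column sums defines a
bounded operator. -/
theorem exists_matrixOp {ι : Type*} (k : ι → ι → ℂ) (C : ℝ)
    (hfin : ∀ i, (Function.support (k i)).Finite)
    (hrow : ∀ i (s : Finset ι), ∑ j ∈ s, ‖k i j‖ ≤ C)
    (hcol : ∀ j (s : Finset ι), ∑ i ∈ s, ‖k i j‖ ≤ C) (hC : 0 ≤ C) :
    ∃ T : L2 ι →L[ℂ] L2 ι, ‖T‖ ≤ C ∧ ∀ ψ i, T ψ i = ∑' j, k i j * ψ j := by
  classical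
  have hsupp : ∀ (ψ : ι → ℂ) i, ∑' j, k i j * ψ j = ∑ j ∈ (hfin i).toFinset, k i j * ψ j := by
    intro ψ i
    refine tsum_eq_sum fun j hj => ?_
    have : k i j = 0 := by simpa using hj
    simp [this]
  have key : ∀ (ψ : L2 ι) (F : Finset ι),
      ∑ i ∈ F, ‖∑' j, k i j * ψ j‖ ^ (2 : ℝ≥0∞).toReal ≤ (C * ‖ψ‖) ^ (2 : ℝ≥0∞).toReal := by
    intro ψ F
    simp only [ENNReal.toReal_ofNat, Real.rpow_two]
    let S : Finset ι := F.biUnion fun i => (hfin i).toFinset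
    have hS : ∀ i ∈ F, ∑' j, k i j * ψ j = ∑ j ∈ S, k i j * ψ j := by
      intro i hi
      refine tsum_eq_sum fun j hj => ?_
      have : k i j = 0 := by
        by_contra hne
        exact hj (Finset.mem_biUnion.2 ⟨i, hi, by simpa using hne⟩)
      simp [this]
    have h1 : ∀ i ∈ F, ‖∑' j, k i j * ψ j‖ ^ 2 ≤ C * ∑ j ∈ S, ‖k i j‖ * ‖ψ j‖ ^ 2 := by
      intro i hi
      rw [hS i hi]
      have a1 : ‖∑ j ∈ S, k i j * ψ j‖ ≤ ∑ j ∈ S, ‖k i j‖ * ‖ψ j‖ :=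
        (norm_sum_le _ _).trans_eq (Finset.sum_congr rfl fun j _ => norm_mul _ _)
      have a2 : (∑ j ∈ S, ‖k i j‖ * ‖ψ j‖) ^ 2 ≤
          (∑ j ∈ S, ‖k i j‖) * ∑ j ∈ S, ‖k i j‖ * ‖ψ j‖ ^ 2 :=
        Finset.sum_sq_le_sum_mul_sum_of_sq_le_mul _ (fun _ _ => norm_nonneg _)
          (fun _ _ => by positivity) (fun _ _ => le_of_eq (by ring))
      calc ‖∑ j ∈ S, k i j * ψ j‖ ^ 2 ≤ (∑ j ∈ S, ‖k i j‖ * ‖ψ j‖) ^ 2 := by gcongr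
        _ ≤ _ := a2
        _ ≤ _ := by
          gcongr
          exact hrow i S
    have h2 : ∑ j ∈ S, ‖ψ j‖ ^ 2 ≤ ‖ψ‖ ^ 2 := by
      have := lp.sum_rpow_le_norm_rpow (p := 2) (by simp) ψ S
      simpa only [ENNReal.toReal_ofNat, Real.rpow_two] using this
    calc ∑ i ∈ F, ‖∑' j, k i j * ψ j‖ ^ 2
        ≤ ∑ i ∈ F, C * ∑ j ∈ S, ‖k i j‖ * ‖ψ j‖ ^ 2 := Finset.sum_le_sum h1
      _ = C * ∑ j ∈ S, (∑ i ∈ F, ‖k i j‖) * ‖ψ j‖ ^ 2 := by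
          rw [← Finset.mul_sum, Finset.sum_comm]
          simp_rw [Finset.sum_mul]
      _ ≤ C * ∑ j ∈ S, C * ‖ψ j‖ ^ 2 := by
          gcongr with j hj
          exact hcol j F
      _ = C ^ 2 * ∑ j ∈ S, ‖ψ j‖ ^ 2 := by rw [← Finset.mul_sum]; ring
      _ ≤ C ^ 2 * ‖ψ‖ ^ 2 := by gcongr
      _ = (C * ‖ψ‖) ^ 2 := by ring
  let T : L2 ι →ₗ[ℂ] L2 ι :=
    { toFun := fun ψ => ⟨fun i => ∑' j, k i j * ψ j, memℓp_gen' (key ψ)⟩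
      map_add' := by
        intro ψ φ
        ext i
        change ∑' j, k i j * (ψ j + φ j) = ∑' j, k i j * ψ j + ∑' j, k i j * φ j
        rw [hsupp ψ, hsupp φ, hsupp fun j => ψ j + φ j]
        simp only [mul_add, Finset.sum_add_distrib]
      map_smul' := by
        intro c ψ
        ext i
        change ∑' j, k i j * (c * ψ j) = c * ∑' j, k i j * ψ j
        rw [hsupp ψ, hsupp fun j => c * ψ j, Finset.mul_sum]
        exact Finset.sum_congr rfl fun j _ => mul_left_comm _ _ _ }
  refine ⟨T.mkContinuous C fun ψ => ?_, LinearMap.mkContinuous_norm_le _ hC _, fun ψ i => rfl⟩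
  exact lp.norm_le_of_forall_sum_le (by simp) (by positivity) (key ψ)

/-- A bounded function acts on `ℓ²` by multiplication. -/
theorem exists_diagOp {ι : Type*} (m : ι → ℂ) (C : ℝ) (hC : 0 ≤ C) (hm : ∀ i, ‖m i‖ ≤ C) :
    ∃ T : L2 ι →L[ℂ] L2 ι, ‖T‖ ≤ C ∧ ∀ ψ i, T ψ i = m i * ψ i := by
  classical
  have hsum : ∀ i (s : Finset ι), ∑ j ∈ s, (if i = j then ‖m i‖ else 0) ≤ C := by
    intro i s
    rw [Finset.sum_ite_eq]
    split_ifs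
    exacts [hm i, hC]
  obtain ⟨T, hT1, hT2⟩ := exists_matrixOp (fun i j => if i = j then m i else 0) C
    (fun i => (Set.finite_singleton i).subset fun j hj => by
      by_contra h
      exact hj (if_neg fun h' => h h'.symm))
    (fun i s => by
      refine (Finset.sum_congr rfl fun j _ => ?_).trans_le (hsum i s)
      split_ifs <;> simp)
    (fun j s => by
      refine (Finset.sum_congr rfl fun i _ => ?_).trans_le (hsum j s)
      by_cases h : i = j
      · simp [h]
      · rw [if_neg h, if_neg (Ne.symm h), norm_zero]) hC
  refine ⟨T, hT1, fun ψ i => ?_⟩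
  rw [hT2, tsum_eq_single i]
  · simp
  · intro j hj
    simp [hj.symm]

end Schur

section Product

variable {G : Type*} [ArrowGroupoid G]

variable (G) in
/-- The `ℓ^∞`-direct product `∏_x B(ℓ²(G_x))` over the units `x`: the bounded families
`a = (a_x)_x` of bounded operators, with the norm `‖a‖ = sup_x ‖a_x‖`. -/
def RegularProduct : Type _ :=
  lp (fun x : units G => L2 (SrcFiber x) →L[ℂ] L2 (SrcFiber x)) ∞

noncomputable instance : NonUnitalCStarAlgebra (RegularProduct G) :=
  inferInstanceAs (NonUnitalCStarAlgebra
    (lp (fun x : units G => L2 (SrcFiber x) →L[ℂ] L2 (SrcFiber x)) ∞))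

/-- The family `(a_x)_x` as an element of `∏_x B(ℓ²(G_x))`. -/
def RegularProduct.mk (a : ∀ x : units G, L2 (SrcFiber x) →L[ℂ] L2 (SrcFiber x))
    (h : BddAbove (Set.range fun x => ‖a x‖)) : RegularProduct G :=
  ⟨a, memℓp_infty h⟩

/-- The component `a_x ∈ B(ℓ²(G_x))` of `a ∈ ∏_x B(ℓ²(G_x))`. -/
def RegularProduct.component (a : RegularProduct G) (x : units G) :
    L2 (SrcFiber x) →L[ℂ] L2 (SrcFiber x) :=
  a.1 x

theorem RegularProduct.ext {a b : RegularProduct G} (h : ∀ x, a.component x = b.component x) :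
    a = b :=
  lp.ext (funext h)

theorem RegularProduct.norm_le {a : RegularProduct G} {C : ℝ} (hC : 0 ≤ C)
    (h : ∀ x, ‖a.component x‖ ≤ C) : ‖a‖ ≤ C :=
  lp.norm_le_of_forall_le hC h

section Units

variable [TopologicalSpace G]

/-- For `f ∈ C_0(G⁽⁰⁾)`, the operator on `ℓ²(G_x)` of multiplication by `f ∘ r`. -/
noncomputable def unitsMul (f : C₀(units G, ℂ)) (x : units G) :
    L2 (SrcFiber x) →L[ℂ] L2 (SrcFiber x) :=
  have hT := exists_diagOp (fun g : SrcFiber x => f (rngUnit g.1)) ‖f‖ (norm_nonneg _)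
    fun g => f.toBCF.norm_coe_le_norm (rngUnit g.1)
  LinearMap.mkContinuous
    { toFun := fun ψ => ⟨fun g => f (rngUnit g.1) * ψ g, by
        have : (fun g : SrcFiber x => f (rngUnit g.1) * ψ g) = (hT.choose ψ : SrcFiber x → ℂ) :=
          funext fun g => (hT.choose_spec.2 ψ g).symm
        rw [this]
        exact lp.memℓp _⟩
      map_add' := fun ψ φ => by
        ext g
        exact mul_add _ _ _
      map_smul' := fun c ψ => by
        ext g
        exact mul_left_comm _ _ _ }
    ‖f‖ fun ψ => by
      refine le_trans (le_of_eq (congrArg norm (?_ : _ = hT.choose ψ)))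
        (hT.choose.le_of_opNorm_le hT.choose_spec.1 ψ)
      ext g
      exact (hT.choose_spec.2 ψ g).symm

theorem norm_unitsMul_le (f : C₀(units G, ℂ)) (x : units G) : ‖unitsMul f x‖ ≤ ‖f‖ := by
  obtain ⟨T, hT1, hT2⟩ := exists_diagOp (fun g : SrcFiber x => f (rngUnit g.1)) ‖f‖
    (norm_nonneg _) fun g => f.toBCF.norm_coe_le_norm (rngUnit g.1)
  have : unitsMul f x = T := by
    ext ψ g
    exact (hT2 ψ g).symm
  rw [this]
  exact hT1

/-- The element `(f ∘ r)_x` of `∏_x B(ℓ²(G_x))` given by multiplication operators. -/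
noncomputable def unitsRegular (f : C₀(units G, ℂ)) : RegularProduct G :=
  RegularProduct.mk (unitsMul f) ⟨‖f‖, by rintro _ ⟨x, rfl⟩; exact norm_unitsMul_le f x⟩

end Units

end Product

section Topological

variable {G : Type*} [TopologicalSpace G] [ArrowGroupoid G] [IsEtaleGroupoid G]

theorem continuous_rngUnit : Continuous (rngUnit : G → units G) :=
  IsEtaleGroupoid.isLocalHomeomorph_rng.continuous

theorem continuous_rng : Continuous (rng : G → G) :=
  continuous_subtype_val.comp continuous_rngUnit

theorem continuous_src : Continuous (src : G → G) := by
  have : (src : G → G) = fun g => rng (inv g) := funext fun g => (rng_inv g).symm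
  rw [this]
  exact continuous_rng.comp IsEtaleGroupoid.continuous_inv

theorem isOpen_units : IsOpen (units G) := by
  rw [isOpen_iff_mem_nhds]
  intro x hx
  obtain ⟨e, hxe, he⟩ := IsEtaleGroupoid.isLocalHomeomorph_rng x
  have hU : e.source ∩ rng ⁻¹' e.source ∈ 𝓝 x := by
    refine Filter.inter_mem (e.open_source.mem_nhds hxe) ?_
    refine (e.open_source.preimage continuous_rng).mem_nhds ?_
    change rng x ∈ e.source
    rwa [rng_unit hx]
  refine Filter.mem_of_superset hU fun y hy => ?_
  have h1 : rng y = y := by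
    refine e.injOn hy.2 hy.1 ?_
    rw [← he]
    exact Subtype.ext (rng_rng y)
  change src y = y
  rw [← h1, src_rng]

/-- A compact subset of `G` meets the fibers of `r` in a bounded number of points. -/
theorem exists_card_fiber_le {K : Set G} (hK : IsCompact K) :
    ∃ n : ℕ, ∀ (y : G) (s : Finset G), (∀ g ∈ s, g ∈ K ∧ rng g = y) → s.card ≤ n := by
  classical
  choose e he1 he2 using (IsEtaleGroupoid.isLocalHomeomorph_rng (G := G))
  obtain ⟨t, ht⟩ := hK.elim_finite_subcover (fun g => (e g).source) (fun g => (e g).open_source)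
    (fun g _ => Set.mem_iUnion.2 ⟨g, he1 g⟩)
  refine ⟨t.card, fun y s hs => ?_⟩
  have hch : ∀ g ∈ s, ∃ i ∈ t, g ∈ (e i).source := by
    intro g hg
    obtain ⟨i, hi, hgi⟩ := Set.mem_iUnion₂.1 (ht (hs g hg).1)
    exact ⟨i, hi, hgi⟩
  choose! i hit hi using hch
  refine Finset.card_le_card_of_injOn i hit ?_
  intro g hg h hh hgh
  refine (e (i g)).injOn (hi g hg) (hgh ▸ hi h hh) ?_
  rw [← he2]
  exact Subtype.ext ((hs g hg).2.trans (hs h hh).2.symm)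

theorem finite_support_fiber {f : G → ℂ} (hf : HasCompactSupport f) (y : G) :
    (Function.support f ∩ {g | rng g = y}).Finite := by
  obtain ⟨n, hn⟩ := exists_card_fiber_le hf.isCompact
  by_contra hinf
  obtain ⟨s, hs, hc⟩ := Set.Infinite.exists_subset_card_eq hinf (n + 1)
  have := hn y s fun g hg => ⟨subset_tsupport f (hs hg).1, (hs hg).2⟩
  omega

theorem finite_support_rngFiber {f : G → ℂ} (hf : HasCompactSupport f) (y : units G) :
    (Function.support fun h : RngFiber y => f h.1).Finite := by
  refine Set.Finite.of_finite_image (f := Subtype.val) ?_ Subtype.val_injective.injOn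
  refine (finite_support_fiber hf y.1).subset ?_
  rintro _ ⟨h, hh, rfl⟩
  exact ⟨hh, h.2⟩

theorem summable_rngFiber {f : G → ℂ} (hf : HasCompactSupport f) (y : units G)
    (F : RngFiber y → ℂ) : Summable fun h : RngFiber y => f h.1 * F h := by
  refine summable_of_hasFiniteSupport ((finite_support_rngFiber hf y).subset ?_)
  intro h hh h0
  exact hh (by simp [h0])

theorem finite_support_matrix (x : units G) {f : G → ℂ} (hf : HasCompactSupport f)
    (g : SrcFiber x) :
    (Function.support fun k : SrcFiber x => f (mul g.1 (inv k.1))).Finite := by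
  refine ((finite_support_rngFiber hf (rngUnit g.1)).preimage
    (f := (fiberEquiv x g).symm) (fiberEquiv x g).symm.injective.injOn).subset ?_
  intro k hk
  exact hk

theorem summable_matrix (x : units G) {f : G → ℂ} (hf : HasCompactSupport f) (g : SrcFiber x)
    (ψ : SrcFiber x → ℂ) :
    Summable fun k : SrcFiber x => f (mul g.1 (inv k.1)) * ψ k := by
  refine summable_of_hasFiniteSupport
    ((finite_support_matrix x hf g).subset ?_)
  intro k hk h0
  have h1 : f (mul g.1 (inv k.1)) = 0 := h0
  exact hk (by simp [h1])

theorem exists_sum_rng_le {f : G → ℂ} (hfc : Continuous f) (hf : HasCompactSupport f) :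
    ∃ C : ℝ, 0 ≤ C ∧ ∀ (y : G) (s : Finset G), (∀ g ∈ s, rng g = y) → ∑ g ∈ s, ‖f g‖ ≤ C := by
  classical
  obtain ⟨n, hn⟩ := exists_card_fiber_le hf.isCompact
  obtain ⟨M, hM⟩ := hf.exists_bound_of_continuous hfc
  refine ⟨n * |M|, by positivity, fun y s hs => ?_⟩
  have h1 : ∑ g ∈ s, ‖f g‖ = ∑ g ∈ s.filter fun g => g ∈ tsupport f, ‖f g‖ := by
    refine (Finset.sum_filter_of_ne fun g _ hg => ?_).symm
    exact subset_tsupport f fun h => hg (by simp [h])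
  rw [h1]
  have h2 := Finset.sum_le_card_nsmul (s.filter fun g => g ∈ tsupport f) (fun g => ‖f g‖) |M|
    fun g _ => (hM g).trans (le_abs_self M)
  refine h2.trans ?_
  rw [nsmul_eq_mul]
  gcongr
  exact hn y _ fun g hg => ⟨(Finset.mem_filter.1 hg).2, hs g (Finset.mem_filter.1 hg).1⟩

/-- The function `f^*(g) = conj (f (g⁻¹))`. -/
def involFun (f : G → ℂ) (g : G) : ℂ := star (f (inv g))

/-- The function `(f₁ * f₂)(g) = ∑_{h ∈ G^{r(g)}} f₁(h) f₂(h⁻¹ g)`. -/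
noncomputable def convFun (f₁ f₂ : G → ℂ) (g : G) : ℂ :=
  ∑' h : RngFiber (rngUnit g), f₁ h.1 * f₂ (mul (inv h.1) g)

theorem continuous_involFun {f : G → ℂ} (hf : Continuous f) : Continuous (involFun f) :=
  continuous_star.comp (hf.comp IsEtaleGroupoid.continuous_inv)

theorem hasCompactSupport_involFun [T2Space G] {f : G → ℂ} (hf : HasCompactSupport f) :
    HasCompactSupport (involFun f) := by
  refine HasCompactSupport.intro
    (hf.isCompact.image (IsEtaleGroupoid.continuous_inv (G := G))) fun g hg => ?_
  have : f (inv g) = 0 := by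
    by_contra h
    exact hg ⟨inv g, subset_tsupport f h, inv_inv g⟩
  simp [involFun, this]

theorem hasCompactSupport_convFun [T2Space G] {f₁ f₂ : G → ℂ} (h₁ : HasCompactSupport f₁)
    (h₂ : HasCompactSupport f₂) : HasCompactSupport (convFun f₁ f₂) := by
  have hcl : IsClosed {p : G × G | src p.1 = rng p.2} :=
    isClosed_eq (continuous_src.comp continuous_fst) (continuous_rng.comp continuous_snd)
  have hK : IsCompact (Subtype.val ⁻¹' (tsupport f₁ ×ˢ tsupport f₂) :
      Set {p : G × G // src p.1 = rng p.2}) :=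
    hcl.isClosedEmbedding_subtypeVal.isCompact_preimage (h₁.isCompact.prod h₂.isCompact)
  refine HasCompactSupport.intro (hK.image IsEtaleGroupoid.continuous_mul) fun g hg => ?_
  have : (fun h : RngFiber (rngUnit g) => f₁ h.1 * f₂ (mul (inv h.1) g)) = fun _ => 0 := by
    funext h
    have hr : rng h.1 = rng g := h.2
    by_contra hne
    refine hg ⟨⟨(h.1, mul (inv h.1) g), (rng_inv_mul hr).symm⟩, ⟨?_, ?_⟩, mul_inv_cancel_left hr⟩
    · exact subset_tsupport f₁ fun h0 => hne (by simp [h0])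
    · exact subset_tsupport f₂ fun h0 => hne (by simp [h0])
  rw [convFun, this, tsum_zero]

theorem continuous_convFun_aux [T2Space G] (e : OpenPartialHomeomorph G (units G))
    (he : (rngUnit : G → units G) = e) {f₁ f₂ : G → ℂ} (c₁ : Continuous f₁)
    (h₁ : HasCompactSupport f₁) (hs : tsupport f₁ ⊆ e.source) (c₂ : Continuous f₂) :
    Continuous (convFun f₁ f₂) := by
  have hout : ∀ g, rngUnit g ∉ rngUnit '' tsupport f₁ → convFun f₁ f₂ g = 0 := by
    intro g hg
    have : (fun h : RngFiber (rngUnit g) => f₁ h.1 * f₂ (mul (inv h.1) g)) = fun _ => 0 := by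
      funext h
      have : f₁ h.1 = 0 := by
        by_contra hne
        exact hg ⟨h.1, subset_tsupport f₁ hne, Subtype.ext h.2⟩
      simp [this]
    rw [convFun, this, tsum_zero]
  have hr : ∀ g, rngUnit g ∈ e.target → rngUnit (e.symm (rngUnit g)) = rngUnit g := by
    intro g hg
    have := e.right_inv hg
    rwa [← he] at this
  have hin : ∀ g, rngUnit g ∈ e.target → convFun f₁ f₂ g =
      f₁ (e.symm (rngUnit g)) * f₂ (mul (inv (e.symm (rngUnit g))) g) := by
    intro g hg
    refine tsum_eq_single
      (⟨e.symm (rngUnit g), congrArg Subtype.val (hr g hg)⟩ : RngFiber (rngUnit g)) ?_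
    intro h hne
    have : f₁ h.1 = 0 := by
      by_contra h0
      have hh : h.1 ∈ e.source := hs (subset_tsupport f₁ h0)
      refine hne (Subtype.ext (e.injOn hh (e.map_target hg) ?_))
      rw [← he, hr g hg]
      exact Subtype.ext h.2
    simp [this]
  rw [continuous_iff_continuousAt]
  intro g
  by_cases hg : rngUnit g ∈ e.target
  · have hopen : IsOpen (rngUnit ⁻¹' e.target : Set G) :=
      e.open_target.preimage continuous_rngUnit
    have hcont : ContinuousOn (fun g => f₁ (e.symm (rngUnit g)) *
        f₂ (mul (inv (e.symm (rngUnit g))) g)) (rngUnit ⁻¹' e.target : Set G) := by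
      have hsym : ContinuousOn (fun g : G => e.symm (rngUnit g)) (rngUnit ⁻¹' e.target) :=
        e.continuousOn_symm.comp continuous_rngUnit.continuousOn fun _ h => h
      refine (c₁.comp_continuousOn hsym).mul (c₂.comp_continuousOn ?_)
      rw [continuousOn_iff_continuous_domRestrict] at hsym ⊢
      have hpair : Continuous fun g : (rngUnit ⁻¹' e.target : Set G) =>
          (⟨(inv (e.symm (rngUnit g.1)), g.1),
            (src_inv _).trans (congrArg Subtype.val (hr g.1 g.2))⟩ :
            {p : G × G // src p.1 = rng p.2}) :=
        ((IsEtaleGroupoid.continuous_inv.comp hsym).prodMk continuous_subtype_val).subtype_mk _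
      exact IsEtaleGroupoid.continuous_mul.comp hpair
    refine (hcont.continuousAt (hopen.mem_nhds hg)).congr ?_
    filter_upwards [hopen.mem_nhds hg] with y hy using (hin y hy).symm
  · have hcl : IsClosed (rngUnit ⁻¹' (rngUnit '' tsupport f₁) : Set G) :=
      (h₁.isCompact.image continuous_rngUnit).isClosed.preimage continuous_rngUnit
    have hg' : g ∈ (rngUnit ⁻¹' (rngUnit '' tsupport f₁) : Set G)ᶜ := by
      rintro ⟨h, hh, hgh⟩
      apply hg
      rw [← hgh, he]
      exact e.map_source (hs hh)
    refine (continuousAt_const (y := (0 : ℂ))).congr ?_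
    filter_upwards [hcl.isOpen_compl.mem_nhds hg'] with y hy using (hout y hy).symm

theorem continuous_convFun [T2Space G] [LocallyCompactSpace G] {f₁ f₂ : G → ℂ}
    (c₁ : Continuous f₁) (h₁ : HasCompactSupport f₁) (c₂ : Continuous f₂) :
    Continuous (convFun f₁ f₂) := by
  classical
  choose e he1 he2 using (IsEtaleGroupoid.isLocalHomeomorph_rng (G := G))
  obtain ⟨t, ht⟩ := h₁.isCompact.elim_finite_subcover (fun g => (e g).source)
    (fun g => (e g).open_source) (fun g _ => Set.mem_iUnion.2 ⟨g, he1 g⟩)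
  let j : Fin t.card ≃ t := t.equivFin.symm
  obtain ⟨χ, hχ1, hχ2, -, hχ4⟩ := exists_continuous_sum_one_of_isOpen_isCompact
    (s := fun i => (e (j i)).source) (fun i => (e (j i)).open_source) h₁.isCompact (by
      intro g hg
      obtain ⟨i, hi, hgi⟩ := Set.mem_iUnion₂.1 (ht hg)
      exact Set.mem_iUnion.2 ⟨j.symm ⟨i, hi⟩, by simpa using hgi⟩)
  let F : Fin t.card → G → ℂ := fun i g => (χ i g : ℂ) * f₁ g
  have hFc : ∀ i, Continuous (F i) := fun i =>
    (Complex.continuous_ofReal.comp (χ i).continuous).mul c₁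
  have hFs : ∀ i, HasCompactSupport (F i) := fun i => h₁.mul_left
  have hFt : ∀ i, tsupport (F i) ⊆ (e (j i)).source := by
    intro i
    refine Set.Subset.trans (closure_mono ?_) (hχ1 i)
    intro g hg h0
    exact hg (by simp [F, h0])
  have hsum : ∀ g, f₁ g = ∑ i, F i g := by
    intro g
    by_cases hg : g ∈ tsupport f₁
    · have h1 : ∑ i, χ i g = 1 := by simpa using hχ2 hg
      rw [← Finset.sum_mul, ← Complex.ofReal_sum, h1, Complex.ofReal_one, one_mul]
    · have h0 : f₁ g = 0 := image_eq_zero_of_notMem_tsupport hg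
      simp [F, h0]
  have hconv : convFun f₁ f₂ = fun g => ∑ i, convFun (F i) f₂ g := by
    funext g
    simp only [convFun]
    rw [← Summable.tsum_finsetSum fun i _ => summable_rngFiber (hFs i) _ _]
    refine tsum_congr fun h => ?_
    rw [hsum h.1, Finset.sum_mul]
  rw [hconv]
  exact continuous_finsetSum _ fun i _ =>
    continuous_convFun_aux _ (he2 _) (hFc i) (hFs i) (hFt i) c₂

end Topological

section Representations

variable {G : Type*} [TopologicalSpace G] [T2Space G] [ArrowGroupoid G] [IsEtaleGroupoid G]

/-- The involution of `C_c(G)`: `f^*(g) = conj (f (g⁻¹))`. -/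
noncomputable def invol (f : C_c(G, ℂ)) : C_c(G, ℂ) where
  toFun g := star (f (inv g))
  continuous_toFun := continuous_involFun f.continuous_toFun
  hasCompactSupport' := hasCompactSupport_involFun f.hasCompactSupport'

/-- The convolution operators on `ℓ²(G_x)` are bounded, uniformly in `x`. -/
theorem exists_regularOp (f : C_c(G, ℂ)) :
    ∃ C : ℝ, 0 ≤ C ∧ ∀ x : units G, ∃ T : L2 (SrcFiber x) →L[ℂ] L2 (SrcFiber x), ‖T‖ ≤ C ∧
      ∀ ψ g, T ψ g = ∑' h : RngFiber (rngUnit g.1), f h.1 * ψ (fiberEquiv x g h) := by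
  classical
  obtain ⟨C, hC, h1⟩ := exists_sum_rng_le f.continuous_toFun f.hasCompactSupport'
  obtain ⟨D, hD, h2⟩ := exists_sum_rng_le (continuous_involFun f.continuous_toFun)
    (hasCompactSupport_involFun f.hasCompactSupport')
  refine ⟨max C D, le_max_of_le_left hC, fun x => ?_⟩
  have hrow : ∀ (g : SrcFiber x) (s : Finset (SrcFiber x)),
      ∑ k ∈ s, ‖f (mul g.1 (inv k.1))‖ ≤ max C D := by
    intro g s
    have hinj : Set.InjOn (fun k : SrcFiber x => mul g.1 (inv k.1)) s := by
      intro k _ l _ hkl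
      exact (fiberEquiv x g).symm.injective (Subtype.ext hkl)
    rw [← Finset.sum_image (f := fun a => ‖f a‖) hinj]
    refine (h1 (rng g.1) _ fun a ha => ?_).trans (le_max_left _ _)
    obtain ⟨k, -, rfl⟩ := Finset.mem_image.1 ha
    exact rng_mul_inv (g.2.trans k.2.symm)
  have hcol : ∀ (k : SrcFiber x) (s : Finset (SrcFiber x)),
      ∑ g ∈ s, ‖f (mul g.1 (inv k.1))‖ ≤ max C D := by
    intro k s
    have hinj : Set.InjOn (fun g : SrcFiber x => mul k.1 (inv g.1)) s := by
      intro g _ l _ hkl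
      exact (fiberEquiv x k).symm.injective (Subtype.ext hkl)
    have hnorm : ∀ g : SrcFiber x,
        ‖f (mul g.1 (inv k.1))‖ = ‖invol f (mul k.1 (inv g.1))‖ := by
      intro g
      change _ = ‖star (f (inv (mul k.1 (inv g.1))))‖
      rw [norm_star, inv_mul_rev ((k.2.trans g.2.symm).trans (rng_inv _).symm), inv_inv]
    simp_rw [hnorm]
    rw [← Finset.sum_image (f := fun a => ‖invol f a‖) hinj]
    refine (h2 (rng k.1) _ fun a ha => ?_).trans (le_max_right _ _)
    obtain ⟨g, -, rfl⟩ := Finset.mem_image.1 ha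
    exact rng_mul_inv (k.2.trans g.2.symm)
  obtain ⟨T, hT1, hT2⟩ := exists_matrixOp
    (fun g k : SrcFiber x => f (mul g.1 (inv k.1))) (max C D)
    (finite_support_matrix x f.hasCompactSupport') hrow hcol (le_max_of_le_left hC)
  refine ⟨T, hT1, fun ψ g => ?_⟩
  rw [hT2, tsum_fiber' x f ψ g]

/-- The regular representation `π_x(f)` on `ℓ²(G_x)`:
`(π_x(f) ψ)(g) = ∑_{h ∈ G^{r(g)}} f(h) ψ(h⁻¹ g)`. -/
noncomputable def regularRep (x : units G) (f : C_c(G, ℂ)) :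
    L2 (SrcFiber x) →L[ℂ] L2 (SrcFiber x) :=
  let hT := (exists_regularOp f).choose_spec.2 x
  LinearMap.mkContinuous
    { toFun := fun ψ =>
        ⟨fun g => ∑' h : RngFiber (rngUnit g.1),
            f h.1 * ψ ⟨mul (inv h.1) g.1, (src_inv_mul h.2).trans g.2⟩, by
          have : (fun g => ∑' h : RngFiber (rngUnit g.1), f h.1 * ψ (fiberEquiv x g h)) =
            (hT.choose ψ : SrcFiber x → ℂ) := funext fun g => (hT.choose_spec.2 ψ g).symm
          change Memℓp (fun g => ∑' h : RngFiber (rngUnit g.1), f h.1 * ψ (fiberEquiv x g h)) 2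
          rw [this]
          exact lp.memℓp _⟩
      map_add' := by
        intro ψ φ
        ext g
        have := congrArg (fun η : L2 (SrcFiber x) => η g) (map_add hT.choose ψ φ)
        change hT.choose (ψ + φ) g = hT.choose ψ g + hT.choose φ g at this
        rw [hT.choose_spec.2, hT.choose_spec.2, hT.choose_spec.2] at this
        exact this
      map_smul' := by
        intro c ψ
        ext g
        have := congrArg (fun η : L2 (SrcFiber x) => η g) (map_smul hT.choose c ψ)
        change hT.choose (c • ψ) g = c * hT.choose ψ g at this
        rw [hT.choose_spec.2, hT.choose_spec.2] at this
        exact this }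
    (exists_regularOp f).choose fun ψ => by
      have : ‖hT.choose ψ‖ ≤ (exists_regularOp f).choose * ‖ψ‖ :=
        hT.choose.le_of_opNorm_le hT.choose_spec.1 ψ
      refine le_trans (le_of_eq (congrArg norm (?_ : _ = hT.choose ψ))) this
      ext g
      exact (hT.choose_spec.2 ψ g).symm

theorem regularRep_apply (x : units G) (f : C_c(G, ℂ)) (ψ : L2 (SrcFiber x)) (g : SrcFiber x) :
    regularRep x f ψ g = ∑' h : RngFiber (rngUnit g.1),
      f h.1 * ψ ⟨mul (inv h.1) g.1, (src_inv_mul h.2).trans g.2⟩ :=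
  rfl

theorem regularRep_apply' (x : units G) (f : C_c(G, ℂ)) (ψ : L2 (SrcFiber x)) (g : SrcFiber x) :
    regularRep x f ψ g = ∑' k : SrcFiber x, f (mul g.1 (inv k.1)) * ψ k :=
  tsum_fiber' x f ψ g

theorem exists_norm_regularRep_le (f : C_c(G, ℂ)) :
    ∃ C : ℝ, 0 ≤ C ∧ ∀ x : units G, ‖regularRep x f‖ ≤ C :=
  ⟨_, (exists_regularOp f).choose_spec.1, fun x => by
    have hT := (exists_regularOp f).choose_spec.2 x
    have : regularRep x f = hT.choose := by
      ext ψ g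
      exact (hT.choose_spec.2 ψ g).symm
    rw [this]
    exact hT.choose_spec.1⟩

theorem regularRep_invol (x : units G) (f : C_c(G, ℂ)) :
    regularRep x (invol f) = star (regularRep x f) := by
  classical
  ext φ i
  have h1 : (star (regularRep x f) φ) i =
      inner ℂ (lp.single 2 i (1 : ℂ) : L2 (SrcFiber x)) (star (regularRep x f) φ) := by
    rw [lp.inner_single_left]
    simp
  rw [h1, ContinuousLinearMap.star_eq_adjoint, ContinuousLinearMap.adjoint_inner_right,
    lp.inner_eq_tsum, regularRep_apply']
  refine tsum_congr fun k => ?_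
  have hk : regularRep x f (lp.single 2 i (1 : ℂ)) k = f (mul k.1 (inv i.1)) := by
    rw [regularRep_apply', tsum_eq_single i]
    · simp
    · intro j hj
      simp [hj]
  rw [hk]
  change star (f (inv (mul i.1 (inv k.1)))) * φ k = _
  rw [inv_mul_rev ((i.2.trans k.2.symm).trans (rng_inv _).symm), inv_inv]
  simp [mul_comm]

/-- The map `f ↦ (π_x(f))_x`. The norm of the image of `f` is `‖f‖_r = sup_x ‖π_x(f)‖`. -/
noncomputable def regular : C_c(G, ℂ) →ₗ[ℂ] RegularProduct G where
  toFun f := RegularProduct.mk (fun x => regularRep x f) (by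
    obtain ⟨C, -, hC⟩ := exists_norm_regularRep_le f
    exact ⟨C, by rintro _ ⟨x, rfl⟩; exact hC x⟩)
  map_add' f₁ f₂ := by
    refine RegularProduct.ext fun x => ?_
    ext ψ g
    change regularRep x (f₁ + f₂) ψ g = regularRep x f₁ ψ g + regularRep x f₂ ψ g
    rw [regularRep_apply', regularRep_apply', regularRep_apply']
    refine Eq.trans ?_ ((summable_matrix x f₁.hasCompactSupport' g ψ).tsum_add
      (summable_matrix x f₂.hasCompactSupport' g ψ))
    exact tsum_congr fun k => add_mul _ _ _
  map_smul' c f := by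
    refine RegularProduct.ext fun x => ?_
    ext ψ g
    change regularRep x (c • f) ψ g = c * regularRep x f ψ g
    rw [regularRep_apply', regularRep_apply', ← tsum_mul_left]
    exact tsum_congr fun k => _root_.mul_assoc _ _ _

theorem regular_invol (f : C_c(G, ℂ)) : regular (invol f) = star (regular f) := by
  refine RegularProduct.ext fun x => ?_
  exact regularRep_invol x f

/-- A function `F ∈ C_c(G)` supported in `G⁽⁰⁾` acts by multiplication by `F ∘ r`. -/
theorem regularRep_units (F : C_c(G, ℂ)) (hF : ∀ g ∉ units G, F g = 0) (x : units G)
    (ψ : L2 (SrcFiber x)) (g : SrcFiber x) : regularRep x F ψ g = F (rng g.1) * ψ g := by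
  have hu : rng g.1 ∈ units G := src_rng g.1
  rw [regularRep_apply,
    tsum_eq_single (⟨rng g.1, rng_rng g.1⟩ : RngFiber (rngUnit g.1)) fun h hne => ?_]
  · refine congrArg (fun k => F (rng g.1) * ψ k) (Subtype.ext ?_)
    change mul (inv (rng g.1)) g.1 = g.1
    rw [inv_unit hu, rng_mul_self]
  · have : F h.1 = 0 := hF _ fun hh => hne (Subtype.ext ((rng_unit hh).symm.trans h.2))
    rw [this, zero_mul]

variable [LocallyCompactSpace G]

/-- The convolution product of `C_c(G)`:
`(f₁ * f₂)(g) = ∑_{h ∈ G^{r(g)}} f₁(h) f₂(h⁻¹ g)`. -/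
noncomputable def conv (f₁ f₂ : C_c(G, ℂ)) : C_c(G, ℂ) where
  toFun g := ∑' h : RngFiber (rngUnit g), f₁ h.1 * f₂ (mul (inv h.1) g)
  continuous_toFun :=
    continuous_convFun f₁.continuous_toFun f₁.hasCompactSupport' f₂.continuous_toFun
  hasCompactSupport' := hasCompactSupport_convFun f₁.hasCompactSupport' f₂.hasCompactSupport'

theorem regularRep_conv (x : units G) (f₁ f₂ : C_c(G, ℂ)) :
    regularRep x (conv f₁ f₂) = regularRep x f₁ * regularRep x f₂ := by
  classical
  ext ψ g
  change _ = regularRep x f₁ (regularRep x f₂ ψ) g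
  rw [regularRep_apply', regularRep_apply']
  have hfin := finite_support_matrix x f₁.hasCompactSupport' g
  have hS : ∀ F : SrcFiber x → ℂ, ∑' m : SrcFiber x, f₁ (mul g.1 (inv m.1)) * F m =
      ∑ m ∈ hfin.toFinset, f₁ (mul g.1 (inv m.1)) * F m := by
    intro F
    refine tsum_eq_sum fun m hm => ?_
    have : f₁ (mul g.1 (inv m.1)) = 0 := by
      by_contra h
      exact hm (by simpa using h)
    simp [this]
  have hconv : ∀ k : SrcFiber x, conv f₁ f₂ (mul g.1 (inv k.1)) =
      ∑ m ∈ hfin.toFinset, f₁ (mul g.1 (inv m.1)) * f₂ (mul m.1 (inv k.1)) := by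
    intro k
    have hgk : src g.1 = src k.1 := g.2.trans k.2.symm
    have hr : ∀ y : units G, rngUnit (mul g.1 (inv k.1)) = y →
        conv f₁ f₂ (mul g.1 (inv k.1)) = ∑' h : RngFiber y,
          f₁ h.1 * f₂ (mul (inv h.1) (mul g.1 (inv k.1))) := by
      intro y hy
      subst hy
      rfl
    rw [hr (rngUnit g.1) (Subtype.ext (rng_mul_inv hgk))]
    have h1 : ∀ h : RngFiber (rngUnit g.1), mul (inv h.1) (mul g.1 (inv k.1)) =
        mul (mul (inv h.1) g.1) (inv k.1) := fun h =>
      (mul_assoc _ _ _ ((src_inv _).trans h.2) (hgk.trans (rng_inv _).symm)).symm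
    simp_rw [h1]
    rw [tsum_fiber x g fun a b => f₁ a * f₂ (mul b (inv k.1))]
    exact hS fun m => f₂ (mul m.1 (inv k.1))
  rw [hS]
  simp_rw [hconv, Finset.sum_mul, regularRep_apply', _root_.mul_assoc]
  rw [Summable.tsum_finsetSum fun m _ => ?_]
  · refine Finset.sum_congr rfl fun m _ => ?_
    rw [← tsum_mul_left]
  · exact (summable_matrix x f₂.hasCompactSupport' m ψ).mul_left _

theorem regular_conv (f₁ f₂ : C_c(G, ℂ)) : regular (conv f₁ f₂) = regular f₁ * regular f₂ := by
  refine RegularProduct.ext fun x => ?_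
  exact regularRep_conv x f₁ f₂

variable (G) in
/-- The image of the `*`-algebra `C_c(G)` under `f ↦ (π_x(f))_x`. -/
noncomputable def regularImage : NonUnitalStarSubalgebra ℂ (RegularProduct G) where
  carrier := Set.range (regular : C_c(G, ℂ) →ₗ[ℂ] RegularProduct G)
  add_mem' := by
    rintro _ _ ⟨f₁, rfl⟩ ⟨f₂, rfl⟩
    exact ⟨f₁ + f₂, map_add _ _ _⟩
  zero_mem' := ⟨0, map_zero _⟩
  mul_mem' := by
    rintro _ _ ⟨f₁, rfl⟩ ⟨f₂, rfl⟩
    exact ⟨conv f₁ f₂, regular_conv f₁ f₂⟩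
  smul_mem' := by
    rintro c _ ⟨f, rfl⟩
    exact ⟨c • f, map_smul _ _ _⟩
  star_mem' := by
    rintro _ ⟨f, rfl⟩
    exact ⟨invol f, regular_invol f⟩

variable (G) in
/-- The reduced groupoid `C^*`-algebra `C^*_r(G)`: the completion of `C_c(G)` in the norm
`‖f‖_r = sup_x ‖π_x(f)‖`, realised as the closure of the image of `C_c(G)` in the complete
algebra `∏_x B(ℓ²(G_x))`. -/
noncomputable def reducedCStar : NonUnitalStarSubalgebra ℂ (RegularProduct G) :=
  (regularImage G).topologicalClosure

/-- The canonical map `C_c(G) → C^*_r(G)`. -/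
noncomputable def toReduced (f : C_c(G, ℂ)) : reducedCStar G :=
  ⟨regular f, (regularImage G).le_topologicalClosure ⟨f, rfl⟩⟩

theorem unitsRegular_mem (f : C₀(units G, ℂ)) : unitsRegular f ∈ reducedCStar G := by
  change unitsRegular f ∈ closure (regularImage G : Set (RegularProduct G))
  rw [Metric.mem_closure_iff]
  intro ε hε
  have h1 : ∀ᶠ y in Filter.cocompact (units G), ‖f y‖ < ε / 2 := by
    have := (zero_at_infty f).norm
    rw [norm_zero] at this
    exact this.eventually (gt_mem_nhds (half_pos hε))
  obtain ⟨K, hK, hKf⟩ := Filter.mem_cocompact.1 h1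
  obtain ⟨χ, hχ1, hχ0, hχc, hχ⟩ := exists_continuous_one_zero_of_isCompact
    (hK.image continuous_subtype_val) (isOpen_units (G := G)).isClosed_compl (by
      rw [Set.disjoint_compl_right_iff_subset]
      rintro _ ⟨y, -, rfl⟩
      exact y.2)
  let F : C_c(G, ℂ) :=
    { toFun := fun g => (χ g : ℂ) * f (rngUnit g)
      continuous_toFun := (Complex.continuous_ofReal.comp χ.continuous).mul
        ((map_continuous f).comp continuous_rngUnit)
      hasCompactSupport' := by
        refine HasCompactSupport.mul_right ?_
        exact hχc.comp_left (g := fun r : ℝ => (r : ℂ)) Complex.ofReal_zero }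
  have hF : ∀ g ∉ units G, F g = 0 := by
    intro g hg
    have : χ g = 0 := hχ0 hg
    change (χ g : ℂ) * f (rngUnit g) = 0
    rw [this, Complex.ofReal_zero, zero_mul]
  refine ⟨regular F, ⟨F, rfl⟩, ?_⟩
  rw [dist_eq_norm]
  refine lt_of_le_of_lt ?_ (half_lt_self hε)
  refine RegularProduct.norm_le (half_pos hε).le fun x => ?_
  obtain ⟨T, hT1, hT2⟩ := exists_diagOp
    (fun g : SrcFiber x => f (rngUnit g.1) - F (rng g.1)) (ε / 2) (half_pos hε).le (by
      intro g
      have hr : rngUnit (rng g.1) = rngUnit g.1 := Subtype.ext (rng_rng g.1)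
      change ‖f (rngUnit g.1) - (χ (rng g.1) : ℂ) * f (rngUnit (rng g.1))‖ ≤ ε / 2
      rw [hr]
      by_cases hg : rngUnit g.1 ∈ K
      · have : χ (rng g.1) = 1 := hχ1 ⟨_, hg, rfl⟩
        rw [this, Complex.ofReal_one, one_mul, sub_self, norm_zero]
        exact (half_pos hε).le
      · have h2 : ‖f (rngUnit g.1)‖ < ε / 2 := hKf hg
        have h3 := hχ (rng g.1)
        have h4 : f (rngUnit g.1) - (χ (rng g.1) : ℂ) * f (rngUnit g.1) =
            ((1 - χ (rng g.1) : ℝ) : ℂ) * f (rngUnit g.1) := by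
          push_cast
          ring
        rw [h4, norm_mul, Complex.norm_real, Real.norm_of_nonneg (by linarith [h3.2])]
        nlinarith [h3.1, h3.2, norm_nonneg (f (rngUnit g.1))])
  have : (unitsRegular f - regular F).component x = T := by
    ext ψ g
    rw [hT2, sub_mul, ← regularRep_units F hF]
    rfl
  rw [this]
  exact hT1

/-- The inclusion `C_0(G⁽⁰⁾) ⊆ C^*_r(G)`: it extends the inclusion of `C_c(G⁽⁰⁾)` in `C_c(G)` by
extension by zero, and `f ∈ C_0(G⁽⁰⁾)` acts on each `ℓ²(G_x)` as multiplication by `f ∘ r`. -/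
noncomputable def ofUnits (f : C₀(units G, ℂ)) : reducedCStar G :=
  ⟨unitsRegular f, unitsRegular_mem f⟩

/-- The inclusion of `C_0(G⁽⁰⁾)` is compatible with extension by zero. -/
theorem ofUnits_eq_toReduced (f : C₀(units G, ℂ)) (F : C_c(G, ℂ)) (hF : ∀ g ∉ units G, F g = 0)
    (h : ∀ x : units G, F x = f x) : ofUnits f = toReduced F := by
  refine Subtype.ext (RegularProduct.ext fun x => ?_)
  ext ψ g
  refine Eq.trans ?_ (regularRep_units F hF x ψ g).symm
  exact congrArg (· * ψ g) (h (rngUnit g.1)).symm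

end Representations

/-- For continuous `c : G → ℝ` and `t : ℝ`, the function `ξ ↦ exp(i t c(ξ)) f(ξ)` of `C_c(G)`. -/
noncomputable def phaseMul {G : Type*} [TopologicalSpace G] (c : C(G, ℝ)) (t : ℝ) (f : C_c(G, ℂ)) : C_c(G, ℂ) where
  toFun ξ := Complex.exp (Complex.I * t * c ξ) * f ξ
  continuous_toFun := by
    have := f.continuous_toFun
    exact Continuous.mul (by fun_prop) this
  hasCompactSupport' := f.hasCompactSupport'.mul_left

end ArrowGroupoid

/-- A continuous one-parameter group of automorphisms of `A`: a homomorphism `t ↦ α_t` from `ℝ` to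
the group of `*`-automorphisms of `A` such that `t ↦ α_t(a)` is norm continuous for all `a`. -/
structure IsOneParameterGroup {A : Type*} [NonUnitalNormedRing A] [Module ℂ A] [Star A]
    (α : ℝ → (A ≃⋆ₐ[ℂ] A)) : Prop where
  map_zero : ∀ a, α 0 a = a
  map_add : ∀ s t a, α (s + t) a = α s (α t a)
  continuous : ∀ a, Continuous fun t => α t a

/-! An element `a` of the reduced algebra is determined by the function g ↦ ⟨δ_g, a δ_{s(g)}⟩ on the
groupoid (`reducedCStar_ext`). This function is continuous, is bounded by the norm of `a`, and
returns `f` when `a` comes from `f` in C_c.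

Let β be an automorphism fixing C_0 of the unit space. It commutes with left and right
multiplication by C_0, that is, with cutting down by functions of the range and of the source. An
arrow whose source has trivial isotropy is determined by its range and source, so such cut-downs
separate it from the support of `f`. Since such arrows are dense, β(f) lives on the closed support
of `f` (`mem_tsupport_of_coeff_ne_zero`).

A norm estimate for functions supported in a fixed compact set sharpens this: f(g) = 0 forces
β(f)(g) = 0 (`coeff_eq_zero_of_apply_eq_zero`). Evaluation of β(f) at g is then a scalar multiple of
evaluation of `f`, so β multiplies C_c by a continuous function `m` (`exists_multiplier`).
Compatibility with product, involution and C_0 makes `m` a homomorphism into the circle.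

For a one-parameter group, t ↦ m_t(g) is a continuous character of ℝ, hence exp(i t c(g)).
Uniqueness of the exponent makes `c` additive. Norm continuity in t at 0 is uniform in g after
passing to coefficients, and this gives continuity of `c` (`continuous_of_continuous_exp`). -/

namespace ArrowGroupoid

/-! ### Matrix coefficients of bounded families of operators -/

section Coefficients

variable {G : Type*} [ArrowGroupoid G]

open scoped Classical in
/-- The matrix entry of `a_x ∈ B(ℓ²(G_x))` in row `g` and column `k`, as a functional of
`a = (a_x)_x`. -/
noncomputable def entry (x : units G) (k g : SrcFiber x) : RegularProduct G →L[ℂ] ℂ :=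
  LinearMap.mkContinuous
    { toFun := fun a => a.component x (lp.single 2 k (1 : ℂ)) g
      map_add' := fun _ _ => rfl
      map_smul' := fun _ _ => rfl } 1 fun a => by
    have h1 : ‖a.component x‖ ≤ ‖a‖ := lp.norm_apply_le_norm ENNReal.top_ne_zero a x
    have h2 : ‖(lp.single 2 k (1 : ℂ) : L2 (SrcFiber x))‖ = 1 := by
      rw [lp.norm_single (by norm_num)]
      simp
    calc ‖a.component x (lp.single 2 k (1 : ℂ)) g‖
        ≤ ‖a.component x (lp.single 2 k (1 : ℂ))‖ := lp.norm_apply_le_norm two_ne_zero _ g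
      _ ≤ ‖a.component x‖ * ‖(lp.single 2 k (1 : ℂ) : L2 (SrcFiber x))‖ :=
        (a.component x).le_opNorm _
      _ ≤ 1 * ‖a‖ := by rw [h2, one_mul, mul_one]; exact h1

open scoped Classical in
theorem entry_apply (x : units G) (k g : SrcFiber x) (a : RegularProduct G) :
    entry x k g a = a.component x (lp.single 2 k (1 : ℂ)) g :=
  rfl

theorem norm_entry_apply_le (x : units G) (k g : SrcFiber x) (a : RegularProduct G) :
    ‖entry x k g a‖ ≤ ‖a‖ := by
  refine ((entry x k g).le_of_opNorm_le (LinearMap.mkContinuous_norm_le _ zero_le_one _) a).trans ?_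
  rw [one_mul]

theorem RegularProduct.ext_entry {a b : RegularProduct G}
    (h : ∀ (x : units G) (k g : SrcFiber x), entry x k g a = entry x k g b) : a = b := by
  classical
  refine RegularProduct.ext fun x => ?_
  refine lp.ext_continuousLinearMap ENNReal.ofNat_ne_top fun k => ?_
  ext g
  have := h x k g
  simp only [entry_apply] at this
  simpa using this

/-- The function on `G` that an element of `∏_x B(ℓ²(G_x))` defines through its matrix entries
`⟨δ_g, a_{s(g)} δ_{s(g)}⟩`. -/
noncomputable def coeff (g : G) : RegularProduct G →L[ℂ] ℂ :=
  entry (srcUnit g) ⟨src g, src_src g⟩ ⟨g, rfl⟩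

theorem norm_coeff_le (g : G) (a : RegularProduct G) : ‖coeff g a‖ ≤ ‖a‖ :=
  norm_entry_apply_le _ _ _ a

/-- Multiplication by elements of C_0 acts on coefficients through the range on the left and the
source on the right. This is how the hypothesis that C_0 is fixed gets used pointwise. -/
theorem coeff_unitsRegular_mul_mul [TopologicalSpace G] (h k : C₀(units G, ℂ))
    (a : RegularProduct G) (g : G) :
    coeff g (unitsRegular h * a * unitsRegular k) =
      h (rngUnit g) * coeff g a * k (srcUnit g) := by
  classical
  let e : SrcFiber (srcUnit g) := ⟨src g, src_src g⟩
  -- Since r(s(g)) = s(g), the basis vector at s(g) is an eigenvector of multiplication by k ∘ r.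
  have hk : unitsMul k (srcUnit g) (lp.single 2 e (1 : ℂ)) =
      k (srcUnit g) • (lp.single 2 e (1 : ℂ) : L2 (SrcFiber (srcUnit g))) := by
    ext i
    change k (rngUnit i.1) * (lp.single 2 e (1 : ℂ) : L2 (SrcFiber (srcUnit g))) i =
      k (srcUnit g) * (lp.single 2 e (1 : ℂ) : L2 (SrcFiber (srcUnit g))) i
    by_cases hi : i = e
    · subst hi
      congr 2
      exact Subtype.ext (rng_src g)
    · simp [hi]
  change h (rngUnit g) * (a.component (srcUnit g)
    (unitsMul k (srcUnit g) (lp.single 2 e (1 : ℂ)))) ⟨g, rfl⟩ = _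
  rw [hk, map_smul]
  change h (rngUnit g) * (k (srcUnit g) * coeff g a) = _
  ring

end Coefficients

/-! ### Elements of the reduced algebra as continuous functions -/

section Reduced

variable {G : Type*} [TopologicalSpace G] [T2Space G] [ArrowGroupoid G] [IsEtaleGroupoid G]

theorem entry_regular (x : units G) (k g : SrcFiber x) (f : C_c(G, ℂ)) :
    entry x k g (regular f) = f (mul g.1 (inv k.1)) := by
  classical
  change regularRep x f (lp.single 2 k (1 : ℂ)) g = _
  rw [regularRep_apply', tsum_eq_single k]
  · simp
  · intro j hj
    simp [hj]

theorem coeff_regular (f : C_c(G, ℂ)) (g : G) : coeff g (regular f) = f g := by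
  refine (entry_regular _ _ _ f).trans ?_
  change f (mul g (inv (src g))) = f g
  rw [inv_unit (src_src g), mul_src_self]

/-- Schur's test: row and column sums of the matrix f(g k⁻¹) have at most as many nonzero terms as
K, respectively K⁻¹, has points in a fiber of r. The constant depends on K alone, so uniformly small
functions supported in K are small in norm. -/
theorem exists_norm_regular_le_of_support {K : Set G} (hK : IsCompact K) :
    ∃ C : ℝ, 0 ≤ C ∧ ∀ (f : C_c(G, ℂ)) (M : ℝ), 0 ≤ M → (∀ g ∉ K, f g = 0) → (∀ g, ‖f g‖ ≤ M) →
      ‖regular f‖ ≤ C * M := by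
  classical
  obtain ⟨n, hn⟩ := exists_card_fiber_le hK
  obtain ⟨m, hm⟩ := exists_card_fiber_le (hK.image (IsEtaleGroupoid.continuous_inv (G := G)))
  -- The set and the function are left general (no continuity), so that the same bound serves `f` on
  -- K for rows and g ↦ f(g⁻¹) on K⁻¹ for columns.
  have bound : ∀ {L : Set G} {N : ℕ}, (∀ (y : G) (s : Finset G), (∀ g ∈ s, g ∈ L ∧ rng g = y) →
      s.card ≤ N) → ∀ (f : G → ℂ) (M : ℝ), 0 ≤ M → (∀ g ∉ L, f g = 0) → (∀ g, ‖f g‖ ≤ M) →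
      ∀ (x : units G) (g : SrcFiber x) (s : Finset (SrcFiber x)),
        ∑ k ∈ s, ‖f (mul g.1 (inv k.1))‖ ≤ N * M := by
    intro L N hN f M hM hf hfM x g s
    have hinj : Set.InjOn (fun k : SrcFiber x => mul g.1 (inv k.1)) s := by
      intro k _ l _ hkl
      exact (fiberEquiv x g).symm.injective (Subtype.ext hkl)
    rw [← Finset.sum_image (f := fun a => ‖f a‖) hinj]
    set S := s.image fun k : SrcFiber x => mul g.1 (inv k.1)
    have h1 : ∑ a ∈ S, ‖f a‖ = ∑ a ∈ S.filter fun a => a ∈ L, ‖f a‖ := by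
      refine (Finset.sum_filter_of_ne fun a _ ha => ?_).symm
      by_contra h
      exact ha (by simp [hf a h])
    rw [h1]
    refine (Finset.sum_le_card_nsmul _ _ M fun a _ => hfM a).trans ?_
    rw [nsmul_eq_mul]
    gcongr
    refine hN (rng g.1) _ fun a ha => ⟨(Finset.mem_filter.1 ha).2, ?_⟩
    obtain ⟨k, -, rfl⟩ := Finset.mem_image.1 (Finset.mem_filter.1 ha).1
    exact rng_mul_inv (g.2.trans k.2.symm)
  refine ⟨max (n : ℝ) m, by positivity, fun f M hM hf hfM => ?_⟩
  refine RegularProduct.norm_le (by positivity) fun x => ?_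
  have hrow : ∀ (g : SrcFiber x) (s : Finset (SrcFiber x)),
      ∑ k ∈ s, ‖f (mul g.1 (inv k.1))‖ ≤ max (n : ℝ) m * M := fun g s =>
    (bound hn f M hM hf hfM x g s).trans
      (mul_le_mul_of_nonneg_right (le_max_left (n : ℝ) m) hM)
  have hcol : ∀ (k : SrcFiber x) (s : Finset (SrcFiber x)),
      ∑ g ∈ s, ‖f (mul g.1 (inv k.1))‖ ≤ max (n : ℝ) m * M := by
    intro k s
    have hnorm : ∀ g : SrcFiber x,
        ‖f (mul g.1 (inv k.1))‖ = ‖(fun a => f (inv a)) (mul k.1 (inv g.1))‖ := by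
      intro g
      change _ = ‖f (inv (mul k.1 (inv g.1)))‖
      rw [inv_mul_rev ((k.2.trans g.2.symm).trans (rng_inv _).symm), inv_inv]
    simp_rw [hnorm]
    refine (bound hm (fun a => f (inv a)) M hM (fun a ha => hf _ fun h => ?_) (fun a => hfM _)
      x k s).trans (mul_le_mul_of_nonneg_right (le_max_right (n : ℝ) m) hM)
    exact ha ⟨inv a, h, inv_inv a⟩
  obtain ⟨T, hT1, hT2⟩ := exists_matrixOp
    (fun g k : SrcFiber x => f (mul g.1 (inv k.1))) (max (n : ℝ) m * M)
    (finite_support_matrix x f.hasCompactSupport') hrow hcol (by positivity)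
  have : (regular f).component x = T := by
    ext ψ g
    rw [hT2]
    exact regularRep_apply' x f ψ g
  rw [this]
  exact hT1

variable [LocallyCompactSpace G]

/-- For `f` in C_c both sides equal f(g k⁻¹), and both are continuous in `a`, so the equality passes
to the closure. Thus all matrix entries are recovered from a single function on the groupoid. -/
theorem entry_eq_coeff {a : RegularProduct G} (ha : a ∈ reducedCStar G) (x : units G)
    (k g : SrcFiber x) : entry x k g a = coeff (mul g.1 (inv k.1)) a := by
  have hcl : IsClosed {a : RegularProduct G | entry x k g a = coeff (mul g.1 (inv k.1)) a} :=
    isClosed_eq (entry x k g).continuous (coeff _).continuous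
  refine closure_minimal ?_ hcl ha
  rintro _ ⟨f, rfl⟩
  exact (entry_regular x k g f).trans (coeff_regular f _).symm

theorem reducedCStar_ext {a b : reducedCStar G} (h : ∀ g, coeff g a.1 = coeff g b.1) : a = b := by
  refine Subtype.ext (RegularProduct.ext_entry fun x k g => ?_)
  rw [entry_eq_coeff a.2, entry_eq_coeff b.2, h]

/-- Coefficients are dominated by the norm, so the coefficient function of `a` is a uniform limit of
functions in C_c. -/
theorem continuous_coeff {a : RegularProduct G} (ha : a ∈ reducedCStar G) :
    Continuous fun g => coeff g a := by
  have ha' : a ∈ closure (Set.range (regular : C_c(G, ℂ) → RegularProduct G)) := ha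
  obtain ⟨u, hu, hlim⟩ := mem_closure_iff_seq_limit.1 ha'
  have : TendstoUniformly (fun n g => coeff g (u n)) (fun g => coeff g a) Filter.atTop := by
    rw [Metric.tendstoUniformly_iff]
    intro ε hε
    filter_upwards [Metric.tendsto_nhds.1 hlim ε hε] with n hn g
    rw [dist_comm, dist_eq_norm, ← map_sub]
    rw [dist_eq_norm] at hn
    exact (norm_coeff_le g _).trans_lt hn
  refine this.continuous (Filter.Frequently.of_forall fun n => ?_)
  obtain ⟨f, hf⟩ := hu n
  simp_rw [← hf, coeff_regular]
  exact f.continuous_toFun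

theorem coeff_toReduced (f : C_c(G, ℂ)) (g : G) : coeff g (toReduced f).1 = f g :=
  coeff_regular f g

theorem toReduced_add (f₁ f₂ : C_c(G, ℂ)) :
    toReduced (f₁ + f₂) = toReduced f₁ + toReduced f₂ :=
  Subtype.ext (map_add _ _ _)

theorem toReduced_smul (c : ℂ) (f : C_c(G, ℂ)) : toReduced (c • f) = c • toReduced f :=
  Subtype.ext (map_smul _ _ _)

theorem toReduced_conv (f₁ f₂ : C_c(G, ℂ)) :
    toReduced (conv f₁ f₂) = toReduced f₁ * toReduced f₂ :=
  Subtype.ext (regular_conv f₁ f₂)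

theorem toReduced_invol (f : C_c(G, ℂ)) : toReduced (invol f) = star (toReduced f) :=
  Subtype.ext (regular_invol f)

theorem isClosed_reducedCStar : IsClosed (reducedCStar G : Set (RegularProduct G)) :=
  NonUnitalStarSubalgebra.isClosed_topologicalClosure _

/-- A `*`-automorphism of `C^*_r(G)` is contractive. -/
theorem norm_starAlgEquiv_apply_le (β : reducedCStar G ≃⋆ₐ[ℂ] reducedCStar G)
    (a : reducedCStar G) : ‖β a‖ ≤ ‖a‖ := by
  let _ : NonUnitalCStarAlgebra (reducedCStar G) :=
    NonUnitalStarSubalgebra.nonUnitalCStarAlgebra (h_closed := isClosed_reducedCStar) _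
  exact NonUnitalStarAlgHom.norm_apply_le β a

theorem norm_coeff_starAlgEquiv_le (β : reducedCStar G ≃⋆ₐ[ℂ] reducedCStar G)
    (f : C_c(G, ℂ)) (g : G) : ‖coeff g (β (toReduced f)).1‖ ≤ ‖regular f‖ :=
  (norm_coeff_le g _).trans (norm_starAlgEquiv_apply_le β (toReduced f))

end Reduced

end ArrowGroupoid

/-! ### Bump functions -/

/-- The value 1 is needed on a neighbourhood: then f - χ f vanishes near the point, which therefore
lies outside its closed support, and one bump function can detect a multiplier at all nearby points.
-/
theorem exists_compactlySupported_eventually_eq_one {X : Type*} [TopologicalSpace X] [T2Space X]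
    [LocallyCompactSpace X] {x : X} {U : Set X} (hU : U ∈ 𝓝 x) :
    ∃ f : C_c(X, ℂ), (∀ᶠ y in 𝓝 x, f y = 1) ∧ (∀ y ∉ U, f y = 0) ∧ ∀ y, ‖f y‖ ≤ 1 := by
  obtain ⟨V, hVU, hV, hxV⟩ := mem_nhds_iff.1 hU
  obtain ⟨K, hK, hxK, hKV⟩ := exists_compact_subset hV hxV
  obtain ⟨χ, h1, h0, hc, h01⟩ := exists_continuous_one_zero_of_isCompact hK hV.isClosed_compl
    (Set.disjoint_compl_right_iff_subset.2 hKV)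
  refine ⟨{ toFun := fun y => (χ y : ℂ)
            continuous_toFun := Complex.continuous_ofReal.comp χ.continuous
            hasCompactSupport' := hc.comp_left (g := fun r : ℝ => (r : ℂ)) Complex.ofReal_zero },
    ?_, fun y hy => ?_, fun y => ?_⟩
  · filter_upwards [isOpen_interior.mem_nhds hxK] with y hy
    have : χ y = 1 := h1 (interior_subset hy)
    change (χ y : ℂ) = 1
    rw [this, Complex.ofReal_one]
  · have : χ y = 0 := h0 fun h => hy (hVU h)
    change (χ y : ℂ) = 0
    rw [this, Complex.ofReal_zero]
  · change ‖(χ y : ℂ)‖ ≤ 1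
    rw [Complex.norm_real, Real.norm_of_nonneg (h01 y).1]
    exact (h01 y).2

theorem exists_zeroAtInfty_eq_one {X : Type*} [TopologicalSpace X] [T2Space X]
    [LocallyCompactSpace X] {x : X} {U : Set X} (hU : U ∈ 𝓝 x) :
    ∃ f : C₀(X, ℂ), f x = 1 ∧ ∀ y ∉ U, f y = 0 := by
  obtain ⟨f, h1, h0, -⟩ := exists_compactlySupported_eventually_eq_one hU
  exact ⟨⟨f.toContinuousMap, f.hasCompactSupport'.is_zero_at_infty⟩, h1.self_of_nhds, h0⟩

/-! ### Openness of the source map and convolution on a bisection -/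

namespace ArrowGroupoid

/-- The pointwise product of a continuous function with a function in `C_c(G)`. -/
noncomputable def pointwiseMul {G : Type*} [TopologicalSpace G] (m : C(G, ℂ)) (f : C_c(G, ℂ)) :
    C_c(G, ℂ) where
  toFun g := m g * f g
  continuous_toFun := m.continuous.mul f.continuous_toFun
  hasCompactSupport' := f.hasCompactSupport'.mul_left

variable {G : Type*} [TopologicalSpace G] [ArrowGroupoid G] [IsEtaleGroupoid G]

/-- Needed because preimages of dense sets under open maps are dense: density of units with trivial
isotropy becomes density of arrows with such a source. -/
theorem isOpenMap_srcUnit : IsOpenMap (srcUnit : G → units G) := by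
  have h : (srcUnit : G → units G) = rngUnit ∘ inv :=
    funext fun g => Subtype.ext (rng_inv g).symm
  rw [h]
  refine IsEtaleGroupoid.isLocalHomeomorph_rng.isOpenMap.comp ?_
  exact (Homeomorph.mk ⟨inv, inv, inv_inv, inv_inv⟩ IsEtaleGroupoid.continuous_inv
    IsEtaleGroupoid.continuous_inv : G ≃ₜ G).isOpenMap

theorem continuous_srcUnit : Continuous (srcUnit : G → units G) :=
  continuous_src.subtype_mk _

variable [LocallyCompactSpace G]

instance : LocallyCompactSpace (units G) :=
  isOpen_units.locallyCompactSpace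

variable [T2Space G]

/-- The range map is injective on `e.source`, so `g` is the only arrow there with the range of gh
and the convolution sum has a single term. -/
theorem conv_apply_mul (e : OpenPartialHomeomorph G (units G))
    (he : (rngUnit : G → units G) = e) {f₁ : C_c(G, ℂ)} (f₂ : C_c(G, ℂ))
    (h₁ : ∀ k ∉ e.source, f₁ k = 0) {g h : G} (hg : g ∈ e.source) (hgh : src g = rng h) :
    conv f₁ f₂ (mul g h) = f₁ g * f₂ h := by
  have hr := rng_mul g h hgh
  change ∑' k : RngFiber (rngUnit (mul g h)), f₁ k.1 * f₂ (mul (inv k.1) (mul g h)) = _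
  rw [tsum_eq_single (⟨g, hr.symm⟩ : RngFiber (rngUnit (mul g h))) fun k hk => ?_]
  · rw [inv_mul_cancel_left hgh]
  · rw [h₁ k.1 fun hks => hk (Subtype.ext (e.injOn hks hg ?_)), zero_mul]
    rw [← he]
    exact Subtype.ext (k.2.trans hr)

/-! ### Automorphisms fixing C_0 of the unit space act by multipliers -/

section Automorphism

variable {β : reducedCStar G ≃⋆ₐ[ℂ] reducedCStar G}

/-- If not, the open set where β(f) is nonzero off the support of `f` contains an arrow k whose
source has trivial isotropy. Functions u, v concentrated near r(k), s(k) satisfy u f v = 0, while u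
β(f) v keeps the nonzero coefficient at k. -/
theorem mem_tsupport_of_coeff_ne_zero
    (hG : Dense {x : units G | ∀ g : G, src g = x → rng g = x → g = x})
    (hβ : ∀ f : C₀(units G, ℂ), β (ofUnits f) = ofUnits f)
    (f : C_c(G, ℂ)) (g : G)
    (hg : coeff g (β (toReduced f)).1 ≠ 0) : g ∈ tsupport f := by
  by_contra hgf
  have hopen : IsOpen ({g | coeff g (β (toReduced f)).1 ≠ 0} ∩ (tsupport f)ᶜ) :=
    (isOpen_ne_fun (continuous_coeff (β (toReduced f)).2) continuous_const).inter
      (isClosed_tsupport f).isOpen_compl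
  obtain ⟨k, ⟨hk, hkf⟩, hiso⟩ := (hG.preimage isOpenMap_srcUnit).inter_open_nonempty _ hopen
    ⟨g, hg, hgf⟩
  have hK : IsCompact ((fun l : G => (rngUnit l, srcUnit l)) '' tsupport f) :=
    f.hasCompactSupport'.isCompact.image (continuous_rngUnit.prodMk continuous_srcUnit)
  have hkK : (rngUnit k, srcUnit k) ∈ ((fun l : G => (rngUnit l, srcUnit l)) '' tsupport f)ᶜ := by
    rintro ⟨l, hl, hlk⟩
    have hr : rng l = rng k := congrArg (fun p => (p.1 : G)) hlk
    have hs : src l = src k := congrArg (fun p => (p.2 : G)) hlk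
    -- An arrow l with the same range and source as k gives the isotropy element l⁻¹k at s(k); it is
    -- trivial, so k = l would lie in the support.
    have h1 : mul (inv l) k = src k :=
      hiso _ (src_inv_mul hr) ((rng_inv_mul hr).trans hs)
    have h2 := mul_inv_cancel_left hr (g := l) (h := k)
    rw [h1, ← hs, mul_src_self] at h2
    exact hkf (h2 ▸ hl)
  obtain ⟨V, hV, W, hW, hVW⟩ := mem_nhds_prod_iff.1 (hK.isClosed.isOpen_compl.mem_nhds hkK)
  obtain ⟨u, hu1, hu0⟩ := exists_zeroAtInfty_eq_one hV
  obtain ⟨v, hv1, hv0⟩ := exists_zeroAtInfty_eq_one hW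
  have hzero : ofUnits u * toReduced f * ofUnits v = 0 := by
    refine reducedCStar_ext fun l => ?_
    refine (coeff_unitsRegular_mul_mul u v (regular f) l).trans ?_
    rw [coeff_regular]
    refine Eq.trans ?_ (map_zero (coeff l)).symm
    by_cases hl : f l = 0
    · simp [hl]
    · by_cases h1 : rngUnit l ∈ V
      · by_cases h2 : srcUnit l ∈ W
        · exact absurd ⟨l, subset_tsupport f hl, rfl⟩ (hVW (Set.mk_mem_prod h1 h2))
        · simp [hv0 _ h2]
      · simp [hu0 _ h1]
  have h3 := congrArg β hzero
  rw [map_mul, map_mul, hβ, hβ, map_zero] at h3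
  have h4 := coeff_unitsRegular_mul_mul u v (β (toReduced f)).1 k
  rw [hu1, hv1, one_mul, mul_one] at h4
  refine hk (h4.symm.trans ?_)
  refine (congrArg (fun a : reducedCStar G => coeff k a.1) h3).trans ?_
  exact map_zero (coeff k)

/-- Cut `f` near g into a part p, uniformly small and supported in the support of `f`, and a
remainder vanishing near g. The remainder contributes nothing at g by the support lemma, and p
contributes at most ε because β is contractive. -/
theorem coeff_eq_zero_of_apply_eq_zero
    (hG : Dense {x : units G | ∀ g : G, src g = x → rng g = x → g = x})
    (hβ : ∀ f : C₀(units G, ℂ), β (ofUnits f) = ofUnits f)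
    (f : C_c(G, ℂ)) (g : G) (hg : f g = 0) :
    coeff g (β (toReduced f)).1 = 0 := by
  obtain ⟨C, hC, hK⟩ := exists_norm_regular_le_of_support f.hasCompactSupport'.isCompact
  rw [← norm_le_zero_iff]
  refine le_of_forall_pos_le_add fun ε hε => ?_
  rw [zero_add]
  -- Using C + 1 avoids dividing by zero when C = 0 and still gives C · ε / (C + 1) ≤ ε.
  have hδ : 0 < ε / (C + 1) := by positivity
  have hV : {y | ‖f y‖ < ε / (C + 1)} ∈ 𝓝 g := by
    refine (isOpen_lt f.continuous_toFun.norm continuous_const).mem_nhds ?_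
    change ‖f g‖ < _
    rwa [hg, norm_zero]
  obtain ⟨χ, h1, h0, hle⟩ := exists_compactlySupported_eventually_eq_one hV
  let p := pointwiseMul χ.toContinuousMap f
  have hp : ∀ y, p y = χ y * f y := fun _ => rfl
  have hsplit : toReduced f = toReduced p + toReduced (f - p) := by
    rw [← toReduced_add, add_sub_cancel]
  have hrest : coeff g (β (toReduced (f - p))).1 = 0 := by
    by_contra hne
    refine notMem_tsupport_iff_eventuallyEq.2 ?_ (mem_tsupport_of_coeff_ne_zero hG hβ _ g hne)
    filter_upwards [h1] with y hy
    change f y - p y = 0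
    rw [hp, hy, one_mul, sub_self]
  have hco : coeff g (β (toReduced f)).1 = coeff g (β (toReduced p)).1 := by
    rw [hsplit, map_add]
    change coeff g ((β (toReduced p)).1 + (β (toReduced (f - p))).1) = _
    rw [map_add, hrest, add_zero]
  rw [hco]
  refine (norm_coeff_starAlgEquiv_le β p g).trans
    ((hK p (ε / (C + 1)) hδ.le (fun y hy => ?_) fun y => ?_).trans ?_)
  · have : f y = 0 := image_eq_zero_of_notMem_tsupport hy
    rw [hp, this, mul_zero]
  · rw [hp]
    by_cases hy : ‖f y‖ < ε / (C + 1)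
    · rw [norm_mul]
      exact (mul_le_of_le_one_left (norm_nonneg _) (hle y)).trans hy.le
    · rw [h0 y hy, zero_mul, norm_zero]
      exact hδ.le
  · rw [mul_div_assoc', div_le_iff₀ (by positivity)]
    nlinarith

/-- An automorphism of `C^*_r(G)` that fixes `C_0(G⁽⁰⁾)` multiplies the functions in `C_c(G)` by a
fixed continuous function. -/
theorem exists_multiplier
    (hG : Dense {x : units G | ∀ g : G, src g = x → rng g = x → g = x})
    (hβ : ∀ f : C₀(units G, ℂ), β (ofUnits f) = ofUnits f) :
    ∃ m : C(G, ℂ), ∀ f : C_c(G, ℂ), β (toReduced f) = toReduced (pointwiseMul m f) := by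
  choose b hb1 hb0 hb using fun g : G =>
    exists_compactlySupported_eventually_eq_one (Filter.univ_mem (f := 𝓝 g))
  have key : ∀ (f : C_c(G, ℂ)) (g : G),
      coeff g (β (toReduced f)).1 = coeff g (β (toReduced (b g))).1 * f g := by
    intro f g
    -- The function f - f(g) b_g vanishes at g, so its image under β does as well.
    have h1 : coeff g (β (toReduced (f + (-f g) • b g))).1 = 0 := by
      refine coeff_eq_zero_of_apply_eq_zero hG hβ _ g ?_
      change f g + (-f g) * b g g = 0
      rw [(hb1 g).self_of_nhds]
      ring
    rw [toReduced_add, toReduced_smul, map_add, map_smul] at h1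
    change coeff g ((β (toReduced f)).1 + (-f g) • (β (toReduced (b g))).1) = 0 at h1
    rw [map_add, map_smul, smul_eq_mul] at h1
    linear_combination h1
  refine ⟨⟨fun g => coeff g (β (toReduced (b g))).1, ?_⟩, fun f => ?_⟩
  · rw [continuous_iff_continuousAt]
    intro g
    -- Near g the bump b_g equals 1, so there the multiplier agrees with the continuous coefficient
    -- function of β(b_g), although its definition uses a different bump at each point.
    refine (continuous_coeff (β (toReduced (b g))).2).continuousAt.congr ?_
    filter_upwards [hb1 g] with y hy
    rw [key, hy, mul_one]
  · refine reducedCStar_ext fun g => ?_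
    rw [coeff_toReduced]
    exact key f g

end Automorphism

/-! ### The multiplier is a homomorphism into the circle -/

section Multiplier

variable {β : reducedCStar G ≃⋆ₐ[ℂ] reducedCStar G} {m : C(G, ℂ)}

/-- Test β(f₁ * f₂) = β(f₁) * β(f₂) at gh, with f₁ supported in a bisection around g so that both
convolutions reduce to one term. -/
theorem multiplier_mul
    (hm : ∀ f : C_c(G, ℂ), β (toReduced f) = toReduced (pointwiseMul m f))
    {g h : G} (hgh : src g = rng h) : m (mul g h) = m g * m h := by
  obtain ⟨e, hge, he⟩ := IsEtaleGroupoid.isLocalHomeomorph_rng g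
  obtain ⟨f₁, hf₁, hf₁', -⟩ :=
    exists_compactlySupported_eventually_eq_one (e.open_source.mem_nhds hge)
  obtain ⟨f₂, hf₂, -⟩ :=
    exists_compactlySupported_eventually_eq_one (Filter.univ_mem (f := 𝓝 h))
  have h1 := hm (conv f₁ f₂)
  rw [toReduced_conv, map_mul, hm, hm, ← toReduced_conv] at h1
  have h2 := congrArg (fun a : reducedCStar G => coeff (mul g h) a.1) h1
  simp only [coeff_toReduced] at h2
  rw [conv_apply_mul e he _ (fun k hk => ?_) hge hgh] at h2
  · change m g * f₁ g * (m h * f₂ h) = m (mul g h) * conv f₁ f₂ (mul g h) at h2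
    rw [conv_apply_mul e he _ hf₁' hge hgh, hf₁.self_of_nhds, hf₂.self_of_nhds] at h2
    linear_combination -h2
  · change m k * f₁ k = 0
    rw [hf₁' k hk, mul_zero]

theorem multiplier_inv
    (hm : ∀ f : C_c(G, ℂ), β (toReduced f) = toReduced (pointwiseMul m f))
    (g : G) : m (inv g) = star (m g) := by
  obtain ⟨f, hf, -⟩ := exists_compactlySupported_eventually_eq_one (Filter.univ_mem (f := 𝓝 g))
  have h1 := hm (invol f)
  rw [toReduced_invol, map_star, hm, ← toReduced_invol] at h1
  have h2 := congrArg (fun a : reducedCStar G => coeff (inv g) a.1) h1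
  simp only [coeff_toReduced] at h2
  change star (m (inv (inv g)) * f (inv (inv g))) = m (inv g) * star (f (inv (inv g))) at h2
  rw [inv_inv, hf.self_of_nhds, star_one, mul_one, mul_one] at h2
  exact h2.symm

/-- A bump function supported in the open unit space belongs to C_0, hence is fixed by β. -/
theorem multiplier_unit
    (hm : ∀ f : C_c(G, ℂ), β (toReduced f) = toReduced (pointwiseMul m f))
    (hβ : ∀ f : C₀(units G, ℂ), β (ofUnits f) = ofUnits f) {x : G}
    (hx : x ∈ units G) : m x = 1 := by
  obtain ⟨f, hf, hf0, -⟩ :=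
    exists_compactlySupported_eventually_eq_one (isOpen_units.mem_nhds hx)
  have hcl : IsClosed (units G) := isClosed_eq continuous_src continuous_id
  let u : C₀(units G, ℂ) :=
    ⟨f.toContinuousMap.comp ⟨Subtype.val, continuous_subtype_val⟩,
      (f.hasCompactSupport'.comp_isClosedEmbedding
        hcl.isClosedEmbedding_subtypeVal).is_zero_at_infty⟩
  have h1 := hm f
  rw [← ofUnits_eq_toReduced u f hf0 fun _ => rfl, hβ,
    ofUnits_eq_toReduced u f hf0 fun _ => rfl] at h1
  have h2 := congrArg (fun a : reducedCStar G => coeff x a.1) h1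
  simp only [coeff_toReduced] at h2
  change f x = m x * f x at h2
  rw [hf.self_of_nhds, mul_one] at h2
  exact h2.symm

/-- By the preceding identities |m(g)|² = m(g) m(g⁻¹) = m(r(g)) = 1. -/
theorem norm_multiplier
    (hm : ∀ f : C_c(G, ℂ), β (toReduced f) = toReduced (pointwiseMul m f))
    (hβ : ∀ f : C₀(units G, ℂ), β (ofUnits f) = ofUnits f) (g : G) :
    ‖m g‖ = 1 := by
  have h1 := multiplier_mul hm (rng_inv g).symm
  rw [mul_inv, multiplier_unit hm hβ (src_rng g), multiplier_inv hm] at h1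
  have h2 := congrArg norm h1
  rw [norm_one, norm_mul, norm_star] at h2
  nlinarith [norm_nonneg (m g)]

end Multiplier

end ArrowGroupoid

/-! ### Characters of the real line and continuity of their exponents -/

/-- A continuous homomorphism from `ℝ` to the unit circle is `t ↦ exp(i t c)` for some `c : ℝ`. -/
theorem exists_eq_exp_of_continuous_of_map_add {m : ℝ → ℂ} (hc : Continuous m)
    (hadd : ∀ s t, m (s + t) = m s * m t) (hn : ∀ t, ‖m t‖ = 1) :
    ∃ c : ℝ, ∀ t : ℝ, m t = Complex.exp (Complex.I * t * c) := by
  have hne : ∀ t, m t ≠ 0 := fun t h => by simpa [h] using hn t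
  have h0 : m 0 = 1 := by
    have := hadd 0 0
    rw [add_zero] at this
    exact mul_left_cancel₀ (hne 0) (by rw [← this, mul_one])
  -- Integrating the functional equation gives m(t) Φ(a) = Φ(a + t) - Φ(t). Once Φ(a) ≠ 0, this
  -- makes `m` differentiable.
  let Φ : ℝ → ℂ := fun t => ∫ s in (0 : ℝ)..t, m s
  have hΦ : ∀ t, HasDerivAt Φ (m t) t := fun t => hc.integral_hasStrictDerivAt 0 t |>.hasDerivAt
  obtain ⟨a, ha⟩ : ∃ a, Φ a ≠ 0 := by
    by_contra! h
    have h1 := hΦ 0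
    rw [show Φ = fun _ => 0 from funext h] at h1
    exact hne 0 (h1.unique (hasDerivAt_const 0 0))
  have hm : ∀ t, m t = (Φ (a + t) - Φ t) / Φ a := by
    intro t
    rw [eq_div_iff ha]
    have h1 : Φ (a + t) - Φ t = ∫ s in t..(a + t), m s :=
      intervalIntegral.integral_interval_sub_left (hc.intervalIntegrable _ _)
        (hc.intervalIntegrable _ _)
    have h2 := intervalIntegral.integral_comp_add_right (a := 0) (b := a) m t
    rw [zero_add] at h2
    rw [h1, ← h2]
    simp_rw [hadd, mul_comm _ (m t)]
    rw [intervalIntegral.integral_const_mul]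
  -- Differentiating that formula gives m'(t) = (m(a + t) - m(t)) / Φ(a) = z m(t).
  let z : ℂ := (m a - 1) / Φ a
  have hder : ∀ t, HasDerivAt m (z * m t) t := by
    intro t
    have h1 := (((hΦ (a + t)).comp_const_add a t).sub (hΦ t)).div_const (Φ a)
    refine (h1.congr_of_eventuallyEq (Filter.Eventually.of_forall hm)).congr_deriv ?_
    rw [hadd]
    simp only [z]
    ring
  have hexp : ∀ t : ℝ, m t = Complex.exp (z * t) := by
    intro t
    have hq : ∀ t : ℝ, HasDerivAt (fun t : ℝ => m t * Complex.exp (-z * t)) 0 t := by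
      intro t
      have h1 : HasDerivAt (fun t : ℝ => Complex.exp (-z * t)) (Complex.exp (-z * t) * (-z * 1)) t :=
        ((Complex.ofRealCLM.hasDerivAt (x := t)).const_mul (-z)).cexp
      refine ((hder t).mul h1).congr_deriv ?_
      ring
    have h2 := is_const_of_deriv_eq_zero (fun t => (hq t).differentiableAt)
      (fun t => (hq t).deriv) t 0
    simp only [h0, Complex.ofReal_zero, mul_zero, Complex.exp_zero, mul_one] at h2
    rw [neg_mul, Complex.exp_neg] at h2
    exact (mul_inv_eq_one₀ (Complex.exp_ne_zero _)).1 h2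
  have hre : z.re = 0 := by
    have h1 := hn 1
    rw [hexp, Complex.norm_exp] at h1
    simpa using h1
  refine ⟨z.im, fun t => ?_⟩
  rw [hexp]
  congr 1
  apply Complex.ext <;> simp [hre, mul_comm]

/-- Compare derivatives at t = 0. -/
theorem eq_of_forall_exp_eq {a b : ℝ}
    (h : ∀ t : ℝ, Complex.exp (Complex.I * t * a) = Complex.exp (Complex.I * t * b)) : a = b := by
  have hd : ∀ c : ℝ, HasDerivAt (fun t : ℝ => Complex.exp (Complex.I * t * c))
      (Complex.I * c) 0 := by
    intro c
    have h1 := (((Complex.ofRealCLM.hasDerivAt (x := (0 : ℝ))).const_mul Complex.I).mul_const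
      (c : ℂ)).cexp
    simpa using h1
  have h1 := (hd a).unique ((hd b).congr_of_eventuallyEq (Filter.Eventually.of_forall h))
  exact_mod_cast mul_left_cancel₀ Complex.I_ne_zero h1

/-- If the functions `exp(i t c)` are uniformly close to `1` locally and for small `t`, and
continuous for each `t`, then `c` is continuous. -/
theorem continuous_of_continuous_exp {X : Type*} [TopologicalSpace X] {c : X → ℝ}
    (hc : ∀ t : ℝ, Continuous fun x => Complex.exp (Complex.I * t * c x))
    (hloc : ∀ x, ∃ δ > 0, ∀ᶠ y in 𝓝 x, ∀ t : ℝ, |t| ≤ δ →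
      ‖Complex.exp (Complex.I * t * c y) - 1‖ < 1) : Continuous c := by
  rw [continuous_iff_continuousAt]
  intro x
  obtain ⟨δ, hδ, h⟩ := hloc x
  -- Otherwise t = π / c(y) is an admissible time at which the exponential equals -1, at distance 2
  -- from 1.
  have hπ : ∀ y, (∀ t : ℝ, |t| ≤ δ → ‖Complex.exp (Complex.I * t * c y) - 1‖ < 1) →
      δ * |c y| < Real.pi := by
    intro y hy
    by_contra! hle
    have hpos : 0 < |c y| := by
      by_contra! h0
      nlinarith [Real.pi_pos, abs_nonneg (c y)]
    have hc0 : c y ≠ 0 := abs_pos.1 hpos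
    have h1 := hy (Real.pi / c y) (by
      rw [abs_div, abs_of_pos Real.pi_pos, div_le_iff₀ hpos]
      exact hle)
    have h2 : Complex.I * ((Real.pi / c y : ℝ) : ℂ) * c y = Real.pi * Complex.I := by
      have : (c y : ℂ) ≠ 0 := Complex.ofReal_ne_zero.2 hc0
      push_cast
      field_simp
    rw [h2, Complex.exp_pi_mul_I] at h1
    norm_num at h1
  -- As |δ c(y)| < π, the principal argument recovers δ c(y), so near x the function `c` is a
  -- composite with `Complex.arg`.
  have harg : ∀ y, (∀ t : ℝ, |t| ≤ δ → ‖Complex.exp (Complex.I * t * c y) - 1‖ < 1) →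
      Complex.arg (Complex.exp (Complex.I * δ * c y)) / δ = c y := by
    intro y hy
    have h1 := hπ y hy
    rw [← abs_of_pos hδ, ← abs_mul, abs_lt] at h1
    have h2 : Complex.I * δ * c y = ((δ * c y : ℝ) : ℂ) * Complex.I := by
      push_cast
      ring
    rw [h2, Complex.arg_exp_mul_I, (toIocMod_eq_self _).2 ⟨h1.1, by linarith [h1.2]⟩]
    field_simp
  have hslit : Complex.exp (Complex.I * δ * c x) ∈ Complex.slitPlane := by
    have h1 := h.self_of_nhds δ (abs_of_pos hδ).le
    have h2 := Complex.mem_slitPlane_of_norm_lt_one h1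
    rwa [add_sub_cancel] at h2
  refine (((Complex.continuousAt_arg hslit).comp (f := fun y => Complex.exp (Complex.I * δ * c y))
    (hc δ).continuousAt).div_const δ).congr ?_
  filter_upwards [h] with y hy
  exact harg y hy

/-! ### Assembling the cocycle -/

open ArrowGroupoid in
theorem mainTheorem7 {G : Type*} [TopologicalSpace G] [T2Space G] [LocallyCompactSpace G]
    [ArrowGroupoid G] [IsEtaleGroupoid G]
    (hG : Dense {x : units G | ∀ g : G, src g = x → rng g = x → g = x})
    (α : ℝ → (reducedCStar G ≃⋆ₐ[ℂ] reducedCStar G)) (hα : IsOneParameterGroup α)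
    (hfix : ∀ (t : ℝ) (f : C₀(units G, ℂ)), α t (ofUnits f) = ofUnits f) :
    ∃ c : C(G, ℝ),
      (∀ g h : G, src g = rng h → c (mul g h) = c g + c h) ∧
      ∀ (t : ℝ) (f : C_c(G, ℂ)), α t (toReduced f) = toReduced (phaseMul c t f) := by
  choose m hm using fun t => exists_multiplier hG (hfix t)
  choose b hb using fun g : G =>
    exists_compactlySupported_eventually_eq_one (Filter.univ_mem (f := 𝓝 g))
  have hmb : ∀ (t : ℝ) (f : C_c(G, ℂ)) (g : G), f g = 1 →
      coeff g (α t (toReduced f)).1 = m t g := by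
    intro t f g hf
    rw [hm, coeff_toReduced]
    change m t g * f g = m t g
    rw [hf, mul_one]
  have hadd : ∀ g s t, m (s + t) g = m s g * m t g := by
    intro g s t
    have hbg := (hb g).1.self_of_nhds
    rw [← hmb (s + t) (b g) g hbg, hα.map_add, hm, hm, coeff_toReduced]
    change m s g * (m t g * b g g) = _
    rw [hbg, mul_one]
  have hcont : ∀ g, Continuous fun t => m t g := by
    intro g
    have h1 := (coeff g).continuous.comp
      (continuous_subtype_val.comp (hα.continuous (toReduced (b g))))
    exact h1.congr fun t => hmb t (b g) g (hb g).1.self_of_nhds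
  choose c hc using fun g => exists_eq_exp_of_continuous_of_map_add (hcont g) (hadd g)
    fun t => norm_multiplier (hm t) (hfix t) g
  have hcc : Continuous c := by
    refine continuous_of_continuous_exp (fun t => ?_) fun g => ?_
    · exact (m t).continuous.congr fun g => hc g t
    · have h1 : ∀ᶠ t in 𝓝 (0 : ℝ), ‖α t (toReduced (b g)) - toReduced (b g)‖ < 1 := by
        have h2 := ((hα.continuous (toReduced (b g))).sub
          (continuous_const (y := toReduced (b g)))).norm.tendsto' 0 0 (by
            change ‖α 0 (toReduced (b g)) - toReduced (b g)‖ = 0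
            rw [hα.map_zero, sub_self, norm_zero])
        exact h2.eventually (gt_mem_nhds one_pos)
      obtain ⟨δ, hδ, h2⟩ := Metric.nhds_basis_closedBall.eventually_iff.1 h1
      refine ⟨δ, hδ, ?_⟩
      filter_upwards [(hb g).1] with y hy t ht
      have h3 : ‖α t (toReduced (b g)) - toReduced (b g)‖ < 1 :=
        h2 (by rwa [Metric.mem_closedBall, dist_zero_right, Real.norm_eq_abs])
      refine lt_of_le_of_lt ?_ h3
      rw [← hc, ← hmb t (b g) y hy, ← hy, ← coeff_toReduced (b g) y, ← map_sub]
      exact norm_coeff_le y _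
  refine ⟨⟨c, hcc⟩, fun g h hgh => ?_, fun t f => ?_⟩
  · refine eq_of_forall_exp_eq fun t => ?_
    change Complex.exp (Complex.I * t * c (mul g h)) =
      Complex.exp (Complex.I * t * ((c g + c h : ℝ) : ℂ))
    rw [← hc, multiplier_mul (hm t) hgh, hc, hc, ← Complex.exp_add]
    congr 1
    push_cast
    ring
  · rw [hm]
    refine reducedCStar_ext fun g => ?_
    rw [coeff_toReduced, coeff_toReduced]
    change m t g * f g = Complex.exp (Complex.I * t * c g) * f g
    rw [hc]
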